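/- Let $M,k>0$ and $\ell\in\mathbb N$ with $\ell\ge 2$; write $L=\ell(\ell+1)$. Let $\Delta(r)=r^2+k^2r^4-2Mr$ and $w=\Delta/r^4$, and let $r^\star$ be the tortoise coordinate defined by $\frac{dr^\star}{dr}=\frac{r^2}{\Delta}$, $r^\star(r=+\infty)=\frac{\pi}{2}$; put $r^\star_{3M}=r^\star(r=3M)$. On $[r^\star_{3M},\pi/2]$ the radius $r\in[3M,\infty]$ and $w$ are regarded as functions of $r^\star$ (so $w=k^2$ and $\frac{6M}{r}=0$ at $\pi/2$), and $'$ denotes $\frac{d}{dr^\star}$. Consider the eigenvalue problem, for $\omega\in\mathbb R$ and smooth $R:[r^\star_{3M},\pi/2]\to\mathbb R$, $$\omega^2R=-R''+w\Big(L-\frac{6M}{r}\Big)R,\qquad R(r^\star_{3M})=0,\qquad \Big(-2\omega^2R+\frac{L(L-2)}{6M}R'+k^2L\,R\Big)\Big(\frac{\pi}{2}\Big)=0; \tag{P}$$ $\omega^2$ is an eigenvalue of (P) if (P) has a solution $R\not\equiv 0$. Let $H^1_0((r^\star_{3M},\pi/2])$ be the closure, for the standard $H^1$ norm, of the space of smooth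 real functions with compact support contained in $(r^\star_{3M},\pi/2]$, and let $$a(u,v)=\int_{r^\star_{3M}}^{\pi/2}\Big(u'v'+w\Big(L-\frac{6M}{r}\Big)uv\Big)\,dr^\star+\frac{6Mk^2}{L-2}\int_{r^\star_{3M}}^{\pi/2}(u'v+uv')\,dr^\star .$$ Then $a$ is a scalar product on $H^1_0((r^\star_{3M},\pi/2])$ whose norm is equivalent to the $H^1$ norm, and there are real numbers $(\omega_{\ell,n})_{n\in\mathbb N}$ and functions $(R_{\ell,n})_{n\in\mathbb N}$, smooth on $[r^\star_{3M},\pi/2]$, such that: 1. $(R_{\ell,n})_{n\in\mathbb N}$ is a Hilbert basis of $H^1_0((r^\star_{3M},\pi/2])$ for $a$ (it is $a$-orthonormal and its linear span is dense); 2. for every $n$, $R_{\ell,n}$ is a solution of (P) with $\omega=\omega_{\ell,n}$, and the set of eigenvalues of (P) is $\{\omega_{\ell,n}^2: n\in\mathbb N\}$; 3. $\omega_\ell^2:=\omega_{\ell,0}^2$ is the lowest eigenvalue of (P), and $$\omega_\ell^2=\inf_{R\in H^1_0((r^\star_{3M},\pi/2])\setminus\{0\}}\frac{\displaystyle\int_{r^\star_{3M}}^{\pi/2}\Big((R')^2+w\Big(L-\frac{6M}{r}\Big)R^2\Big)\,dr^\star+\frac{6Mk^2}{L-2}\,R\big(\tfrac{\pi}{2}\big)^2}{\displaystyle\int_{r^\star_{3M}}^{\pi/2}R^2\,dr^\star+\frac{12M}{L(L-2)}\,R\big(\tfrac{\pi}{2}\big)^2},$$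 where $R(\frac{\pi}{2})$ is the value of the continuous representative of $R$; 4. the infimum is attained at $R_{\ell,0}$. -/

import Mathlib

open MeasureTheory Set

noncomputable section

namespace ReggeWheeler

/-! ### Schwarzschild-AdS: the radial coordinates and the potential -/

/-- `Δ(r) = r² + k² r⁴ - 2 M r`. -/
def Delta (M k r : ℝ) : ℝ := r ^ 2 + k ^ 2 * r ^ 4 - 2 * M * r

/-- The weight `w = Δ / r⁴`. -/
def weight (M k r : ℝ) : ℝ := Delta M k r / r ^ 4

/-- The tortoise coordinate `r*(r)`: the primitive of `r² / Δ` with `r*(+∞) = π / 2`. -/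
def tortoise (M k r : ℝ) : ℝ := Real.pi / 2 - ∫ s in Ioi r, s ^ 2 / Delta M k s

/-- `r*` at `r = 3M`, the left end of the truncated interval. -/
def rStar3M (M k : ℝ) : ℝ := tortoise M k (3 * M)

/-- The radius `r ≥ 3M` as a function of the tortoise coordinate: the inverse of
`r* : [3M, ∞) → [r*(3M), π / 2)`. -/
def radius (M k x : ℝ) : ℝ := Function.invFunOn (tortoise M k) (Ici (3 * M)) x

/-- `ℓ (ℓ + 1)` as a real number. -/
def ang (ℓ : ℕ) : ℝ := (ℓ : ℝ) * ((ℓ : ℝ) + 1)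

/-- The potential `w (ℓ(ℓ+1) - 6M/r)` as a function of the tortoise coordinate
`x ∈ [r*(3M), π / 2]`. At `x = π / 2`, that is `r = ∞`, it has its limit value `k² ℓ(ℓ+1)`. -/
def potential (M k : ℝ) (ℓ : ℕ) (x : ℝ) : ℝ :=
  if x < Real.pi / 2 then
    weight M k (radius M k x) * (ang ℓ - 6 * M / radius M k x)
  else k ^ 2 * ang ℓ

/-- The closed interval `[r*(3M), π / 2]`. -/
def interval (M k : ℝ) : Set ℝ := Icc (rStar3M M k) (Real.pi / 2)

/-! ### The truncated Robin Regge-Wheeler eigenvalue problem -/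

/-- `R` is a smooth solution on `[r*(3M), π / 2]`, with frequency `ω`, of
`ω² R = - R'' + w (ℓ(ℓ+1) - 6M/r) R` with the Dirichlet condition at `r*(3M)` and the higher
order Robin condition at `π / 2`. The trivial solution `R = 0` is allowed here. -/
structure IsRobinSolution (M k : ℝ) (ℓ : ℕ) (ω : ℝ) (R : ℝ → ℝ) : Prop where
  smooth : ContDiffOn ℝ (⊤ : ℕ∞) R (interval M k)
  equation : ∀ x ∈ interval M k,
    ω ^ 2 * R x = - iteratedDerivWithin 2 R (interval M k) x + potential M k ℓ x * R x
  dirichlet : R (rStar3M M k) = 0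
  robin :
    - 2 * ω ^ 2 * R (Real.pi / 2)
      + ang ℓ * (ang ℓ - 2) / (6 * M) * derivWithin R (interval M k) (Real.pi / 2)
      + k ^ 2 * ang ℓ * R (Real.pi / 2) = 0

/-- The set of the eigenvalues `ω²`, `ω ∈ ℝ`, of the problem: there is a solution that does not
vanish identically. -/
def eigenvalues (M k : ℝ) (ℓ : ℕ) : Set ℝ :=
  {μ | ∃ (ω : ℝ) (R : ℝ → ℝ), μ = ω ^ 2 ∧ IsRobinSolution M k ℓ ω R ∧
    ∃ x ∈ interval M k, R x ≠ 0}

/-! ### The space `H¹₀((α, β])` -/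

/-- Lebesgue measure on `(α, β)`. -/
abbrev vol (α β : ℝ) : Measure ℝ := volume.restrict (Ioo α β)

/-- The Hilbert space `L²(α, β) × L²(α, β)`, whose norm on a pair `(u, u')` is
`(‖u‖² + ‖u'‖²)^(1/2)`, the standard `H¹` norm. -/
abbrev Ambient (α β : ℝ) : Type :=
  WithLp 2 (Lp ℝ 2 (vol α β) × Lp ℝ 2 (vol α β))

/-- `φ` is smooth with compact support contained in `(α, ∞)`; the restrictions of such functions
to `(α, β]` are the smooth functions with compact support contained in `(α, β]`. -/
structure IsTest (α : ℝ) (φ : ℝ → ℝ) : Prop where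
  smooth : ContDiff ℝ (⊤ : ℕ∞) φ
  compact : HasCompactSupport φ
  support : tsupport φ ⊆ Ioi α

/-- The pairs `(φ, φ')` with `φ` a test function. -/
def testSpace (α β : ℝ) : Submodule ℝ (Ambient α β) where
  carrier := {p | ∃ φ : ℝ → ℝ, IsTest α φ ∧
    (p.fst : ℝ → ℝ) =ᵐ[vol α β] φ ∧ (p.snd : ℝ → ℝ) =ᵐ[vol α β] deriv φ}
  zero_mem' := by
    refine ⟨0, ⟨contDiff_const, HasCompactSupport.zero, by simp [tsupport]⟩, ?_, ?_⟩
    · exact Lp.coeFn_zero _ _ _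
    · have h : deriv (0 : ℝ → ℝ) = 0 := by
        funext x
        exact deriv_const x (0 : ℝ)
      rw [h]
      exact Lp.coeFn_zero _ _ _
  add_mem' := by
    rintro p q ⟨φ, hφ, h1, h2⟩ ⟨ψ, hψ, h3, h4⟩
    refine ⟨φ + ψ, ⟨hφ.smooth.add hψ.smooth, hφ.compact.add hψ.compact, ?_⟩, ?_, ?_⟩
    · exact (tsupport_add φ ψ).trans (union_subset hφ.support hψ.support)
    · exact (Lp.coeFn_add _ _).trans (h1.add h3)
    · have h : deriv (φ + ψ) = deriv φ + deriv ψ := by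
        funext x
        exact deriv_add (hφ.smooth.differentiable (by simp) x)
          (hψ.smooth.differentiable (by simp) x)
      rw [h]
      exact (Lp.coeFn_add _ _).trans (h2.add h4)
  smul_mem' := by
    rintro c p ⟨φ, hφ, h1, h2⟩
    refine ⟨c • φ, ⟨hφ.smooth.const_smul c, hφ.compact.smul_left (f := fun _ => c), ?_⟩, ?_, ?_⟩
    · exact (closure_mono (Function.support_const_smul_subset c φ)).trans hφ.support
    · exact (Lp.coeFn_smul c _).trans (h1.const_smul c)
    · have h : deriv (c • φ) = c • deriv φ := by
        funext x
        exact deriv_const_smul c (hφ.smooth.differentiable (by simp) x)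
      rw [h]
      exact (Lp.coeFn_smul c _).trans (h2.const_smul c)

/-- `H¹₀((α, β])`: the closure, for the `H¹` norm, of the smooth functions with compact support
contained in `(α, β]`. An element is a pair: a function in `L²` and its weak derivative. -/
abbrev H10 (α β : ℝ) : Type := ↥(testSpace α β).topologicalClosure

/-- The function `u` itself (a class modulo null sets). -/
def fn {α β : ℝ} (u : H10 α β) : ℝ → ℝ := (u : Ambient α β).fst

/-- The weak derivative `u'`. -/
def dfn {α β : ℝ} (u : H10 α β) : ℝ → ℝ := (u : Ambient α β).snd

/-- The representative of `u ∈ H¹₀((α, β])` that is continuous on `[α, β]`; the point values of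
`u`, in particular `u β`, are those of this representative. See `rep_ae` and `rep_continuousOn`
for the fact that it is a continuous representative of `u`. -/
def rep {α β : ℝ} (u : H10 α β) (x : ℝ) : ℝ := ∫ t in α..x, dfn u t

theorem integrableOn_dfn {α β : ℝ} (u : H10 α β) : IntegrableOn (dfn u) (Ioo α β) :=
  (Lp.memLp (u : Ambient α β).snd).integrable one_le_two

theorem rep_continuousOn {α β : ℝ} (u : H10 α β) : ContinuousOn (rep u) (Icc α β) := by
  rcases le_or_gt α β with h | h
  · have hi : IntegrableOn (dfn u) (uIcc α β) := by
      rw [uIcc_of_le h, integrableOn_Icc_iff_integrableOn_Ioo]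
      exact integrableOn_dfn u
    have hc := intervalIntegral.continuousOn_primitive_interval hi
    rwa [uIcc_of_le h] at hc
  · rw [Icc_eq_empty (not_le.2 h)]
    exact continuousOn_empty _

theorem rep_ae {α β : ℝ} (u : H10 α β) : fn u =ᵐ[vol α β] rep u := by
  obtain ⟨p, hp, hlim⟩ := mem_closure_iff_seq_limit.1 u.2
  choose φ hφ h1 h2 using hp
  have hfst : Filter.Tendsto (fun n => (p n).fst) Filter.atTop (nhds (u : Ambient α β).fst) :=
    ((WithLp.continuous_fst 2 _ _).tendsto _).comp hlim
  have hsnd : Filter.Tendsto (fun n => (p n).snd) Filter.atTop (nhds (u : Ambient α β).snd) :=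
    ((WithLp.continuous_snd 2 _ _).tendsto _).comp hlim
  obtain ⟨ns, hns, hae⟩ := (tendstoInMeasure_of_tendsto_Lp hfst).exists_seq_tendsto_ae
  have hall : ∀ᵐ x ∂(vol α β), ∀ n, ((p n).fst : ℝ → ℝ) x = φ n x :=
    ae_all_iff.2 h1
  have key : ∀ x ∈ Ioo α β, ∀ v : Lp ℝ 2 (vol α β), ∫ t in α..x, v t =
      inner ℝ (indicatorConstLp 2 (measurableSet_Ioc (a := α) (b := x))
        (measure_ne_top (vol α β) _) (1 : ℝ)) v := by
    intro x hx v
    have hsub : Ioc α x ⊆ Ioo α β := fun t ht => ⟨ht.1, ht.2.trans_lt hx.2⟩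
    rw [L2.inner_indicatorConstLp_one, intervalIntegral.integral_of_le hx.1.le,
      Measure.restrict_restrict measurableSet_Ioc, inter_eq_left.2 hsub]
  filter_upwards [hae, hall, ae_restrict_mem measurableSet_Ioo] with x hx1 hx2 hx
  have hphi : ∀ n, φ n x = ∫ t in α..x, ((p n).snd : ℝ → ℝ) t := by
    intro n
    have e1 : ∫ t in α..x, ((p n).snd : ℝ → ℝ) t = ∫ t in α..x, deriv (φ n) t := by
      rw [intervalIntegral.integral_of_le hx.1.le, intervalIntegral.integral_of_le hx.1.le]
      have hsub : Ioc α x ⊆ Ioo α β := fun t ht => ⟨ht.1, ht.2.trans_lt hx.2⟩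
      exact integral_congr_ae (ae_restrict_of_ae_restrict_of_subset hsub (h2 n))
    have h0 : φ n α = 0 := by
      by_contra hne
      exact lt_irrefl α ((hφ n).support (subset_tsupport _ hne))
    rw [e1, intervalIntegral.integral_deriv_eq_sub
      (fun t _ => (hφ n).smooth.differentiable (by simp) t), h0, sub_zero]
    exact (((hφ n).smooth.continuous_deriv (by simp)).intervalIntegrable _ _)
  have hl : Filter.Tendsto (fun n => φ (ns n) x) Filter.atTop (nhds (fn u x)) := by
    simp only [hx2] at hx1
    exact hx1
  have hr : Filter.Tendsto (fun n => φ (ns n) x) Filter.atTop (nhds (rep u x)) := by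
    simp only [hphi, rep, dfn, key x hx]
    exact ((continuous_const.inner continuous_id).tendsto _).comp
      (hsnd.comp hns.tendsto_atTop)
  exact tendsto_nhds_unique hl hr

/-! ### The scalar product, Hilbert bases and the Rayleigh quotient -/

/-- The space `H¹₀((r*(3M), π / 2])`. -/
abbrev Space (M k : ℝ) : Type := H10 (rStar3M M k) (Real.pi / 2)

/-- `a(u, v) = ∫ (u' v' + w (ℓ(ℓ+1) - 6M/r) u v) + 6Mk² / (ℓ(ℓ+1) - 2) ∫ (u' v + u v')`. -/
def formA (M k : ℝ) (ℓ : ℕ) (u v : Space M k) : ℝ :=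
  (∫ x in Ioo (rStar3M M k) (Real.pi / 2),
    (dfn u x * dfn v x + potential M k ℓ x * fn u x * fn v x))
  + 6 * M * k ^ 2 / (ang ℓ - 2) *
    ∫ x in Ioo (rStar3M M k) (Real.pi / 2), (dfn u x * fn v x + fn u x * dfn v x)

/-- `a` is a scalar product on the real Hilbert space `H` whose norm is equivalent to the norm
of `H` (so that `H` is also a Hilbert space for `a`): it is bilinear, continuous, symmetric and
coercive. -/
def IsHilbertScalarProduct {H : Type*} [NormedAddCommGroup H] [InnerProductSpace ℝ H]
    (a : H → H → ℝ) : Prop :=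
  ∃ B : H →L[ℝ] H →L[ℝ] ℝ, (∀ u v, B u v = a u v) ∧ (∀ u v, a u v = a v u) ∧ IsCoercive B

/-- `e` is a Hilbert basis for the scalar product `a`: it is orthonormal for `a` and the linear
combinations of the `e n` are dense. The topology is that of `H`, and it is used for an `a` that
satisfies `IsHilbertScalarProduct`, whose norm defines the same topology. -/
structure IsHilbertBasisFor {H : Type*} [NormedAddCommGroup H] [InnerProductSpace ℝ H]
    (a : H → H → ℝ) (e : ℕ → H) : Prop where
  orthonormal : ∀ m n, a (e m) (e n) = if m = n then 1 else 0
  total : Dense (Submodule.span ℝ (range e) : Set H)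

/-- The twisted Rayleigh quotient: `∫ ((R')² + w (ℓ(ℓ+1) - 6M/r) R²) + 6Mk²/(ℓ(ℓ+1)-2) R(π/2)²`
divided by `∫ R² + 12M / (ℓ(ℓ+1)(ℓ(ℓ+1)-2)) R(π/2)²`. -/
def twistedRayleigh (M k : ℝ) (ℓ : ℕ) (R : Space M k) : ℝ :=
  ((∫ x in Ioo (rStar3M M k) (Real.pi / 2), (dfn R x ^ 2 + potential M k ℓ x * fn R x ^ 2))
    + 6 * M * k ^ 2 / (ang ℓ - 2) * rep R (Real.pi / 2) ^ 2)
  / ((∫ x in Ioo (rStar3M M k) (Real.pi / 2), fn R x ^ 2)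
    + 12 * M / (ang ℓ * (ang ℓ - 2)) * rep R (Real.pi / 2) ^ 2)

end ReggeWheeler

end

/-! Although ω² enters the boundary condition, the problem is variational. For ℓ ≥ 2 the condition
at π/2 solves for R' there (`robin_iff`), and integration by parts turns (P) into a(u, v) = ω² b(u,
v) for all v, where b(u, v) = ∫ u v + κ u(π/2) v(π/2) and κ is `robinMass`. In a, the integral of
u'v + uv' is just u(π/2) v(π/2), since both functions vanish at the left end
(`integral_dfn_mul_rep_add`).

The form a is coercive: the potential and the boundary coefficient are nonnegative, and the Poincaré
inequality `norm_le_weakDeriv` controls the rest. The form b is positive definite and compact,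
because it factors through the embedding into continuous functions, compact by Arzelà–Ascoli
(`isCompactOperator_toContinuous`); this handles the boundary value along with the integral. The
operator T with a(Tu, v) = b(u, v) is then compact, symmetric and positive for a. Its eigenvectors
form the basis, the inverses of its eigenvalues are the ω², and Parseval gives the Rayleigh bound
(`exists_eigenbasis_of_isCoercive`).

Weak and classical solutions agree by `classical_of_weak` and `weak_of_classical`. Smoothness up to
r = ∞ rests on the variable 1/r, which solves an autonomous polynomial equation in r*, so that the
potential is smooth on the closed interval. No eigenvalue is missed: an eigenfunction for any other
ω² would be a-orthogonal to the whole basis. -/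

noncomputable section

namespace ReggeWheeler

/-! ### Diagonalization of compact symmetric operators -/

universe u

section Spectral

open Filter Topology

variable {E : Type u} [NormedAddCommGroup E] [InnerProductSpace ℝ E]

/-- The eigenspaces of a compact symmetric operator are mutually orthogonal and their sum has
trivial orthogonal complement, so the union of Hilbert bases of all of them is a Hilbert basis.
Every real μ is allowed as an index; trivial eigenspaces contribute nothing. -/
theorem exists_hilbertBasis_eigenvectors [CompleteSpace E] (T : E →L[ℝ] E) (hT : IsCompactOperator T)
    (hs : (T : E →ₗ[ℝ] E).IsSymmetric) :
    ∃ (ι : Type u) (b : HilbertBasis ι ℝ E) (μ : ι → ℝ), ∀ i, T (b i) = μ i • b i := by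
  have hcomplete : ∀ μ : ℝ, CompleteSpace (Module.End.eigenspace (T : E →ₗ[ℝ] E) μ) := by
    intro μ
    have hclosed : IsClosed {x : E | T x = μ • x} :=
      isClosed_eq T.continuous (continuous_const_smul μ)
    have heq : ((Module.End.eigenspace (T : E →ₗ[ℝ] E) μ : Submodule ℝ E) : Set E)
        = {x : E | T x = μ • x} := by
      ext x
      simp
    rw [← heq] at hclosed
    exact hclosed.completeSpace_coe
  choose w b hb using fun μ : ℝ =>
    exists_hilbertBasis ℝ (Module.End.eigenspace (T : E →ₗ[ℝ] E) μ)
  have hon := (hs.orthogonalFamily_eigenspaces).orthonormal_sigma_orthonormal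
    (v_family := fun μ => (b μ : w μ → _)) (fun μ => (b μ).orthonormal)
  refine ⟨(μ : ℝ) × w μ, HilbertBasis.mkOfOrthogonalEqBot hon ?_, fun i => i.1, ?_⟩
  · rw [← T.orthogonalComplement_iSup_eigenspaces_eq_bot hT hs]
    apply le_antisymm
    · intro x hx
      rw [Submodule.mem_orthogonal] at hx ⊢
      -- Orthogonality to the basis vectors passes to the closure of their span, hence to the full
      -- eigenspace.
      have key : ∀ μ : ℝ, Module.End.eigenspace (T : E →ₗ[ℝ] E) μ ≤ (ℝ ∙ x)ᗮ := by
        intro μ y hy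
        set P := (Module.End.eigenspace (T : E →ₗ[ℝ] E) μ).subtypeL with hP
        have hsp : (⊤ : Submodule ℝ (Module.End.eigenspace (T : E →ₗ[ℝ] E) μ)) ≤
            ((ℝ ∙ x)ᗮ).comap P.toLinearMap := by
          rw [← (b μ).dense_span]
          apply Submodule.topologicalClosure_minimal
          · rw [Submodule.span_le]
            rintro _ ⟨i, rfl⟩
            simp only [SetLike.mem_coe, Submodule.mem_comap]
            rw [Submodule.mem_orthogonal_singleton_iff_inner_left]
            exact hx _ (Submodule.subset_span ⟨⟨μ, i⟩, rfl⟩)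
          · exact (Submodule.isClosed_orthogonal _).preimage P.continuous
        exact hsp (Submodule.mem_top (x := ⟨y, hy⟩))
      intro y hy
      exact (Submodule.mem_orthogonal_singleton_iff_inner_left).1 (iSup_le key hy)
    · apply Submodule.orthogonal_le
      rw [Submodule.span_le]
      rintro _ ⟨i, rfl⟩
      exact Submodule.mem_iSup_of_mem i.1 (b i.1 i.2).2
  · intro i
    rw [HilbertBasis.coe_mkOfOrthogonalEqBot]
    exact Module.End.mem_eigenspace_iff.1 (b i.1 i.2).2

/-- Otherwise the images μ i • b i would contain an infinite family with mutual distances at least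
√2 ε, which has no Cauchy subsequence, against compactness. -/
theorem finite_setOf_le_eigenvalue {ι : Type*} {T : E →L[ℝ] E} (hT : IsCompactOperator T)
    {b : ι → E} (hb : Orthonormal ℝ b) {μ : ι → ℝ} (hμ : ∀ i, T (b i) = μ i • b i) {ε : ℝ}
    (hε : 0 < ε) : {i | ε ≤ μ i}.Finite := by
  by_contra hinf
  set f := Set.Infinite.natEmbedding _ hinf
  have hK : IsCompact (closure ((T : E →ₗ[ℝ] E) '' Metric.closedBall 0 1)) :=
    IsCompactOperator.isCompact_closure_image_closedBall (f := (T : E →ₗ[ℝ] E)) hT 1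
  obtain ⟨a, -, φ, hφ, hlim⟩ := hK.tendsto_subseq (x := fun n => T (b (f n))) (fun n =>
    subset_closure ⟨b (f n), by simp [hb.1], rfl⟩)
  obtain ⟨N, hN⟩ := Metric.cauchySeq_iff.1 hlim.cauchySeq ε hε
  have h1 := hN (N + 1) (by omega) N le_rfl
  have hne : (f (φ (N + 1)) : ι) ≠ f (φ N) := fun h =>
    absurd (hφ.injective (f.injective (Subtype.ext h))) (by omega)
  have h2 : ε ≤ μ (f (φ (N + 1))) := (f (φ (N + 1))).2
  have h3 := hb.2 hne
  simp only [Function.comp, dist_eq_norm, hμ] at h1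
  have h4 : ‖μ (f (φ (N + 1))) • b (f (φ (N + 1))) - μ (f (φ N)) • b (f (φ N))‖ ^ 2
      = μ (f (φ (N + 1))) ^ 2 + μ (f (φ N)) ^ 2 := by
    rw [norm_sub_sq_real, inner_smul_left, inner_smul_right, h3, norm_smul, norm_smul, hb.1, hb.1]
    simp
  nlinarith [norm_nonneg (μ (f (φ (N + 1))) • b (f (φ (N + 1))) - μ (f (φ N)) • b (f (φ N))),
    sq_nonneg (μ (f (φ N)))]

/-- Positivity excludes the eigenvalue 0, so the index set is the union of the finite sets {μ ≥
1/(n+1)} and is countable. A largest eigenvalue exists because only finitely many lie above a given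
one. -/
theorem exists_nat_hilbertBasis_eigenvectors [CompleteSpace E] (T : E →L[ℝ] E) (hT : IsCompactOperator T)
    (hs : (T : E →ₗ[ℝ] E).IsSymmetric) (hpos : ∀ x, x ≠ 0 → 0 < inner ℝ (T x) x)
    (hinf : ¬ FiniteDimensional ℝ E) :
    ∃ (b : HilbertBasis ℕ ℝ E) (μ : ℕ → ℝ), (∀ n, T (b n) = μ n • b n) ∧
      (∀ n, 0 < μ n) ∧ ∀ n, μ n ≤ μ 0 := by
  obtain ⟨ι, b, μ, hμ⟩ := exists_hilbertBasis_eigenvectors T hT hs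
  have hμpos : ∀ i, 0 < μ i := by
    intro i
    have h := hpos (b i) (b.orthonormal.ne_zero i)
    rwa [hμ, inner_smul_left, real_inner_self_eq_norm_sq, b.orthonormal.1, one_pow, mul_one] at h
  have hfin : ∀ ε : ℝ, 0 < ε → {i | ε ≤ μ i}.Finite := fun ε hε =>
    finite_setOf_le_eigenvalue hT b.orthonormal hμ hε
  have hcount : Countable ι := by
    rw [← Set.countable_univ_iff]
    have hU : (univ : Set ι) = ⋃ n : ℕ, {i | 1 / ((n : ℝ) + 1) ≤ μ i} := by
      symm
      rw [eq_univ_iff_forall]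
      intro i
      obtain ⟨n, hn⟩ := exists_nat_one_div_lt (hμpos i)
      exact mem_iUnion.2 ⟨n, hn.le⟩
    rw [hU]
    exact countable_iUnion fun n => (hfin _ (by positivity)).countable
  have hInf : Infinite ι := by
    by_contra hI
    have : Finite ι := not_infinite_iff_finite.1 hI
    have := Fintype.ofFinite ι
    exact hinf b.toOrthonormalBasis.toBasis.finiteDimensional_of_finite
  obtain ⟨i0⟩ : Nonempty ι := inferInstance
  obtain ⟨j, hj1, hj⟩ := (hfin (μ i0) (hμpos i0)).exists_maximalFor μ _ ⟨i0, le_refl (μ i0)⟩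
  have hmax : ∀ i, μ i ≤ μ j := by
    intro i
    by_contra! hi
    exact absurd (hj (show μ i0 ≤ μ i from le_trans hj1 hi.le) hi.le) (not_le.2 hi)
  obtain ⟨e0⟩ := nonempty_equiv_of_countable (α := ι) (β := ℕ)
  classical
  -- The swap moves the maximal eigenvalue to index 0; the others stay unordered.
  set e : ι ≃ ℕ := e0.trans (Equiv.swap (e0 j) 0)
  have he : e.symm 0 = j := by simp [e]
  refine ⟨HilbertBasis.mkOfOrthogonalEqBot (v := b ∘ e.symm)
    (b.orthonormal.comp _ e.symm.injective) ?_, μ ∘ e.symm, ?_, fun n => hμpos _, ?_⟩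
  · rw [e.symm.surjective.range_comp, ← Submodule.orthogonal_closure, b.dense_span,
      Submodule.top_orthogonal_eq_bot]
  · intro n
    rw [HilbertBasis.coe_mkOfOrthogonalEqBot]
    exact hμ _
  · intro n
    simp only [Function.comp, he]
    exact hmax _

end Spectral

/-! ### The generalized eigenvalue problem for a coercive form -/

section Form

/-- A copy of `H`, to be normed by a coercive symmetric form. -/
def FormSpace (H : Type u) : Type u := H

instance {H : Type u} [AddCommGroup H] : AddCommGroup (FormSpace H) :=
  inferInstanceAs (AddCommGroup H)

instance {H : Type u} [AddCommGroup H] [Module ℝ H] : Module ℝ (FormSpace H) :=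
  inferInstanceAs (Module ℝ H)

variable {H : Type u} [NormedAddCommGroup H] [InnerProductSpace ℝ H]

/-- The scalar product on `FormSpace H` given by a coercive symmetric form. -/
abbrev formCore (B : H →L[ℝ] H →L[ℝ] ℝ) (hs : ∀ u v, B u v = B v u) (hB : IsCoercive B) :
    InnerProductSpace.Core ℝ (FormSpace H) where
  inner u v := B (show H from u) (show H from v)
  conj_inner_symm u v := hs _ _
  re_inner_nonneg u := by
    obtain ⟨C, hC, h⟩ := hB
    exact le_trans (by positivity) (h (show H from u))
  add_left u v w := by
    change B ((show H from u) + (show H from v)) _ = _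
    rw [map_add]
    rfl
  smul_left u v r := by
    change B (r • (show H from u)) _ = _
    rw [map_smul]
    rfl
  definite u hu := by
    obtain ⟨C, hC, h⟩ := hB
    have h1 := h (show H from u)
    change B (show H from u) (show H from u) = 0 at hu
    rw [hu] at h1
    by_contra hne
    have : 0 < ‖(show H from u)‖ := norm_pos_iff.2 hne
    have : 0 < C * ‖(show H from u)‖ * ‖(show H from u)‖ := by positivity
    linarith

/-- Boundedness and coercivity bound the norm of the form above and below by that of `H`, so
completeness carries over. The operator of interest is symmetric for `B`, so the spectral theorem
must be applied in this norm. -/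
theorem exists_hilbertSpace_of_isCoercive [CompleteSpace H] (B : H →L[ℝ] H →L[ℝ] ℝ) (hs : ∀ u v, B u v = B v u)
    (hB : IsCoercive B) :
    ∃ (K : Type u) (_ : NormedAddCommGroup K) (_ : InnerProductSpace ℝ K) (_ : CompleteSpace K)
      (Φ : H ≃L[ℝ] K), ∀ u v, inner ℝ (Φ u) (Φ v) = B u v := by
  let core := formCore B hs hB
  let i1 : NormedAddCommGroup (FormSpace H) := core.toNormedAddCommGroup
  let i2 : InnerProductSpace ℝ (FormSpace H) := InnerProductSpace.ofCore core.toCore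
  let L : H ≃ₗ[ℝ] FormSpace H :=
    { toFun := fun u => u, invFun := fun u => u, map_add' := fun _ _ => rfl,
      map_smul' := fun _ _ => rfl, left_inv := fun _ => rfl, right_inv := fun _ => rfl }
  have hin : ∀ u v : H, inner ℝ (L u) (L v) = B u v := fun u v => rfl
  have hn : ∀ u : H, ‖L u‖ ^ 2 = B u u := fun u => by
    rw [← real_inner_self_eq_norm_sq, hin]
  have hbound : ∃ C : ℝ, ∀ u : FormSpace H, ‖L.symm u‖ ≤ C * ‖u‖ := by
    obtain ⟨C, hC, h⟩ := hB
    refine ⟨(Real.sqrt C)⁻¹, fun u => ?_⟩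
    obtain ⟨v, rfl⟩ := L.surjective u
    rw [L.symm_apply_apply, ← div_eq_inv_mul, le_div_iff₀ (by positivity)]
    apply le_of_sq_le_sq _ (norm_nonneg _)
    rw [hn, mul_pow, Real.sq_sqrt hC.le]
    linarith [h v]
  obtain ⟨C, hC⟩ := hbound
  let Φ : H ≃L[ℝ] FormSpace H := L.toContinuousLinearEquivOfBounds (Real.sqrt ‖B‖) C (by
    intro u
    apply le_of_sq_le_sq _ (by positivity)
    rw [hn, mul_pow, Real.sq_sqrt (norm_nonneg B)]
    have := (le_abs_self _).trans (B.le_opNorm₂ u u)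
    linarith) hC
  refine ⟨FormSpace H, i1, i2, ?_, Φ, fun u v => rfl⟩
  exact (completeSpace_congr (e := Φ.toEquiv) Φ.isUniformEmbedding).1 inferInstance

theorem exists_eigenbasis_of_isCoercive [CompleteSpace H] (B b : H →L[ℝ] H →L[ℝ] ℝ) (hBs : ∀ u v, B u v = B v u)
    (hB : IsCoercive B) (hbs : ∀ u v, b u v = b v u) (hb : ∀ u, u ≠ 0 → 0 < b u u)
    (hcpt : IsCompactOperator b) (hinf : ¬ FiniteDimensional ℝ H) :
    ∃ (lam : ℕ → ℝ) (e : ℕ → H), (∀ n, 0 < lam n) ∧ (∀ n, lam 0 ≤ lam n) ∧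
      (∀ m n, B (e m) (e n) = if m = n then 1 else 0) ∧
      Dense (Submodule.span ℝ (range e) : Set H) ∧
      (∀ n v, B (e n) v = lam n * b (e n) v) ∧
      ∀ u, lam 0 * b u u ≤ B u u := by
  obtain ⟨K, _, _, _, Φ, hΦ⟩ := exists_hilbertSpace_of_isCoercive B hBs hB
  -- Lax–Milgram: `T0 u` represents the functional `b u` with respect to `B`. Compactness of `b` as
  -- a map into the dual passes to `T0`.
  set T0 : H →L[ℝ] H := (hB.continuousLinearEquivOfBilin.symm : H →L[ℝ] H) ∘L
    (InnerProductSpace.continuousLinearMapOfBilin (𝕜 := ℝ) b) with hT0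
  have hT0B : ∀ u v, B (T0 u) v = b u v := by
    intro u v
    rw [← hB.continuousLinearEquivOfBilin_apply, hT0]
    simp
  have hT0c : IsCompactOperator T0 := by
    have h1 : IsCompactOperator (InnerProductSpace.continuousLinearMapOfBilin (𝕜 := ℝ) b) :=
      hcpt.continuous_comp (InnerProductSpace.toDual ℝ H).symm.continuous
    exact h1.clm_comp (hB.continuousLinearEquivOfBilin.symm : H →L[ℝ] H)
  set T : K →L[ℝ] K := (Φ : H →L[ℝ] K) ∘L T0 ∘L (Φ.symm : K →L[ℝ] H) with hT
  have hTc : IsCompactOperator T := (hT0c.comp_clm (Φ.symm : K →L[ℝ] H)).clm_comp (Φ : H →L[ℝ] K)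
  have hTΦ : ∀ u, T (Φ u) = Φ (T0 u) := fun u => by simp [hT]
  have hTin : ∀ u v, inner ℝ (T (Φ u)) (Φ v) = b u v := fun u v => by
    rw [hTΦ, hΦ, hT0B]
  have hTs : (T : K →ₗ[ℝ] K).IsSymmetric := by
    intro x y
    obtain ⟨u, rfl⟩ := Φ.surjective x
    obtain ⟨v, rfl⟩ := Φ.surjective y
    change inner ℝ (T (Φ u)) (Φ v) = inner ℝ (Φ u) (T (Φ v))
    rw [real_inner_comm (T (Φ v)), hTin, hTin, hbs]
  obtain ⟨f, μ, hf, hμ, hmax⟩ := exists_nat_hilbertBasis_eigenvectors T hTc hTs (by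
      intro x hx
      obtain ⟨u, rfl⟩ := Φ.surjective x
      rw [hTin]
      exact hb u (by rintro rfl; exact hx (map_zero _))) (by
      intro hfd
      exact hinf (Φ.symm.toLinearEquiv.finiteDimensional))
  have hΦe : ∀ n, Φ (Φ.symm (f n)) = f n := fun n => Φ.apply_symm_apply _
  refine ⟨fun n => (μ n)⁻¹, fun n => Φ.symm (f n), fun n => inv_pos.2 (hμ n),
    fun n => inv_anti₀ (hμ n) (hmax n), ?_, ?_, ?_, ?_⟩
  · intro m n
    rw [← hΦ, hΦe, hΦe]
    exact orthonormal_iff_ite.1 f.orthonormal m n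
  · have h1 : Dense (Submodule.span ℝ (range f) : Set K) :=
      (Submodule.dense_iff_topologicalClosure_eq_top).2 f.dense_span
    have h2 := (Φ.symm.surjective.denseRange).dense_image Φ.symm.continuous h1
    have h3 : (Φ.symm '' (Submodule.span ℝ (range f) : Set K))
        = (Submodule.span ℝ (range fun n => Φ.symm (f n)) : Set H) := by
      have := Submodule.map_span (Φ.symm : K →L[ℝ] H).toLinearMap (range f)
      rw [← range_comp] at this
      exact congrArg (fun S : Submodule ℝ H => (S : Set H)) this
    rwa [h3] at h2
  · intro n v
    rw [← hTin, hΦe, ← hΦ, hΦe, hf, inner_smul_left]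
    simp [(hμ n).ne']
  · intro u
    rw [← hTin, ← hΦ, inv_mul_le_iff₀ (hμ 0)]
    -- Parseval expands b(u, u) and μ 0 · B(u, u) in the eigenbasis; the series are compared term by
    -- term using μ n ≤ μ 0.
    have h1 := f.hasSum_inner_mul_inner (T (Φ u)) (Φ u)
    have h2 := (f.hasSum_inner_mul_inner (Φ u) (Φ u)).mul_left (μ 0)
    refine hasSum_le (fun n => ?_) h1 h2
    have h3 : inner ℝ (T (Φ u)) (f n) = μ n * inner ℝ (Φ u) (f n) := by
      rw [show inner ℝ (T (Φ u)) (f n) = inner ℝ (Φ u) (T (f n)) from hTs _ _, hf,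
        inner_smul_right]
    rw [h3, real_inner_comm (Φ u) (f n)]
    have := hmax n
    nlinarith [mul_self_nonneg (inner ℝ (Φ u) (f n))]

end Form

/-! ### Smoothness of solutions of differential equations on a closed interval -/

theorem contDiffOn_nat_succ_of_hasDerivWithinAt {s : Set ℝ} (hs : UniqueDiffOn ℝ s) {f f' : ℝ → ℝ}
    {n : ℕ} (hf : ∀ x ∈ s, HasDerivWithinAt f (f' x) s x) (hf' : ContDiffOn ℝ n f' s) :
    ContDiffOn ℝ ((n + 1 : ℕ) : WithTop ℕ∞) f s := by
  push_cast
  rw [contDiffOn_succ_iff_derivWithin hs]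
  refine ⟨fun x hx => (hf x hx).differentiableWithinAt, fun h => ?_, ?_⟩
  · exact absurd h (by simp)
  · exact hf'.congr fun x hx => (hf x hx).derivWithin (hs x hx)

/-- Bootstrap: f' = p ∘ f is as regular as f, so each step gains one derivative. -/
theorem contDiffOn_of_autonomous {s : Set ℝ} (hs : UniqueDiffOn ℝ s) {f p : ℝ → ℝ}
    (hp : ContDiff ℝ (⊤ : ℕ∞) p) (hf : ∀ x ∈ s, HasDerivWithinAt f (p (f x)) s x) :
    ContDiffOn ℝ (⊤ : ℕ∞) f s := by
  refine contDiffOn_infty.2 fun n => ?_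
  induction n with
  | zero =>
    simp only [Nat.cast_zero, contDiffOn_zero]
    exact fun x hx => (hf x hx).continuousWithinAt
  | succ n ih =>
    exact contDiffOn_nat_succ_of_hasDerivWithinAt hs hf
      ((hp.of_le (mod_cast le_top)).comp_contDiffOn ih)

/-- The same bootstrap for the first-order system in (f, g), both components being carried through
the induction. -/
theorem contDiffOn_of_linear_second_order {s : Set ℝ} (hs : UniqueDiffOn ℝ s) {f g q : ℝ → ℝ}
    (hq : ContDiffOn ℝ (⊤ : ℕ∞) q s) (hf : ∀ x ∈ s, HasDerivWithinAt f (g x) s x)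
    (hg : ∀ x ∈ s, HasDerivWithinAt g (q x * f x) s x) :
    ContDiffOn ℝ (⊤ : ℕ∞) f s := by
  refine contDiffOn_infty.2 fun n => ?_
  suffices h : ContDiffOn ℝ n f s ∧ ContDiffOn ℝ n g s from h.1
  induction n with
  | zero =>
    simp only [Nat.cast_zero, contDiffOn_zero]
    exact ⟨fun x hx => (hf x hx).continuousWithinAt, fun x hx => (hg x hx).continuousWithinAt⟩
  | succ n ih =>
    exact ⟨contDiffOn_nat_succ_of_hasDerivWithinAt hs hf ih.2,
      contDiffOn_nat_succ_of_hasDerivWithinAt hs hg ((hq.of_le (mod_cast le_top)).mul ih.1)⟩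

/-! ### The tortoise coordinate in the variable `1 / r` -/

section Tortoise

variable {M k : ℝ}

/-- The weight `Δ / r⁴` as a function of `1 / r`. -/
def invWeight (M k v : ℝ) : ℝ := k ^ 2 + v ^ 2 - 2 * M * v ^ 3

theorem contDiff_invWeight : ContDiff ℝ (⊤ : ℕ∞) (invWeight M k) := by
  unfold invWeight
  fun_prop

theorem invWeight_pos (hk : 0 < k) {v : ℝ} (hv : 2 * M * v < 1) : 0 < invWeight M k v := by
  have h : invWeight M k v = k ^ 2 + v ^ 2 * (1 - 2 * M * v) := by unfold invWeight; ring
  rw [h]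
  have : 0 < 1 - 2 * M * v := by linarith
  positivity

theorem weight_eq_invWeight {r : ℝ} (hr : 0 < r) : weight M k r = invWeight M k r⁻¹ := by
  unfold weight Delta invWeight
  field_simp
  ring

/-- The primitive of `1 / (k² + v² - 2 M v³)` vanishing at `0`. -/
def invTortoise (M k u : ℝ) : ℝ := ∫ v in (0 : ℝ)..u, (invWeight M k v)⁻¹

theorem hasDerivAt_invTortoise (hM : 0 < M) (hk : 0 < k) {u : ℝ} (hu : 2 * M * u < 1) :
    HasDerivAt (invTortoise M k) (invWeight M k u)⁻¹ u := by
  have hc : ∀ v, 2 * M * v < 1 → ContinuousAt (fun v => (invWeight M k v)⁻¹) v := fun v hv =>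
    contDiff_invWeight.continuous.continuousAt.inv₀ (invWeight_pos hk hv).ne'
  refine intervalIntegral.integral_hasDerivAt_right ?_ ?_ (hc u hu)
  · refine ContinuousOn.intervalIntegrable fun v hv => (hc v ?_).continuousWithinAt
    have h1 : v ≤ max 0 u := hv.2
    rcases le_max_iff.1 h1 with h | h <;> nlinarith
  · exact (contDiff_invWeight.continuous.measurable.inv).stronglyMeasurable.stronglyMeasurableAtFilter

/-- The substitution v = 1/r turns r² dr / Δ into -dv / (k² + v² - 2Mv³), so that r = ∞ becomes the
regular point v = 0. -/
theorem tortoise_eq (hM : 0 < M) (hk : 0 < k) {r : ℝ} (hr : 3 * M ≤ r) :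
    tortoise M k r = Real.pi / 2 - invTortoise M k r⁻¹ := by
  have hpos : ∀ s ∈ Ici r, 0 < s ∧ 2 * M * s⁻¹ < 1 := fun s hs => by
    have h1 : 3 * M ≤ s := hr.trans hs
    have h2 : 0 < s := by linarith
    refine ⟨h2, ?_⟩
    rw [← div_eq_mul_inv, div_lt_one h2]
    linarith
  have hI : ∫ s in Ioi r, s ^ 2 / Delta M k s = 0 - -invTortoise M k r⁻¹ := by
    refine integral_Ioi_of_hasDerivAt_of_nonneg' (g := fun s => -invTortoise M k s⁻¹)
      (fun s hs => ?_) (fun s hs => ?_) ?_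
    · obtain ⟨h1, h2⟩ := hpos s hs
      have h3 := ((hasDerivAt_invTortoise hM hk h2).comp s (hasDerivAt_inv h1.ne')).neg
      refine h3.congr_deriv ?_
      rw [← weight_eq_invWeight h1, weight]
      have hD : Delta M k s ≠ 0 := by
        have := invWeight_pos hk h2
        rw [← weight_eq_invWeight h1, weight] at this
        intro h
        simp [h] at this
      field_simp
    · obtain ⟨h1, h2⟩ := hpos s (Ioi_subset_Ici_self hs)
      have := invWeight_pos hk h2
      rw [← weight_eq_invWeight h1, weight] at this
      have : 0 < Delta M k s := (div_pos_iff_of_pos_right (by positivity)).1 this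
      positivity
    · have h1 : Filter.Tendsto (invTortoise M k) (nhds 0) (nhds (invTortoise M k 0)) :=
        (hasDerivAt_invTortoise hM hk (by simp)).continuousAt
      have h2 := (h1.comp tendsto_inv_atTop_zero).neg
      simpa [invTortoise] using h2
  rw [tortoise, hI]
  ring

theorem two_mul_lt_one_of_le (hM : 0 < M) {u : ℝ} (hu : u ≤ (3 * M)⁻¹) : 2 * M * u < 1 := by
  have : M * u ≤ M * (3 * M)⁻¹ := mul_le_mul_of_nonneg_left hu hM.le
  have h2 : M * (3 * M)⁻¹ = 1 / 3 := by field_simp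
  linarith

theorem strictMonoOn_invTortoise (hM : 0 < M) (hk : 0 < k) :
    StrictMonoOn (invTortoise M k) (Icc 0 (3 * M)⁻¹) := by
  refine strictMonoOn_of_deriv_pos (convex_Icc _ _) (fun u hu =>
    (hasDerivAt_invTortoise hM hk (two_mul_lt_one_of_le hM hu.2)).continuousAt.continuousWithinAt)
    fun u hu => ?_
  rw [interior_Icc] at hu
  have h := two_mul_lt_one_of_le hM hu.2.le
  rw [(hasDerivAt_invTortoise hM hk h).deriv]
  exact inv_pos.2 (invWeight_pos hk h)

theorem rStar3M_eq (hM : 0 < M) (hk : 0 < k) :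
    rStar3M M k = Real.pi / 2 - invTortoise M k (3 * M)⁻¹ := tortoise_eq hM hk le_rfl

theorem rStar3M_lt (hM : 0 < M) (hk : 0 < k) : rStar3M M k < Real.pi / 2 := by
  have h : (0 : ℝ) < (3 * M)⁻¹ := by positivity
  have := strictMonoOn_invTortoise hM hk (left_mem_Icc.2 h.le) (right_mem_Icc.2 h.le) h
  rw [rStar3M_eq hM hk]
  simp only [invTortoise, intervalIntegral.integral_same] at this ⊢
  linarith

/-- `1 / r` as a function of the tortoise coordinate. -/
def invRadius (M k x : ℝ) : ℝ := if x < Real.pi / 2 then (radius M k x)⁻¹ else 0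

/-- `radius` is a chosen inverse, meaningful only where a preimage exists; the intermediate value
theorem for `invTortoise` supplies one when x < π/2. The end x = π/2 corresponds to 1/r = 0. -/
theorem invRadius_spec (hM : 0 < M) (hk : 0 < k) {x : ℝ} (hx : x ∈ interval M k) :
    invRadius M k x ∈ Icc 0 (3 * M)⁻¹ ∧ invTortoise M k (invRadius M k x) = Real.pi / 2 - x := by
  have h3 : (0 : ℝ) < (3 * M)⁻¹ := by positivity
  have hG0 : invTortoise M k 0 = 0 := by simp [invTortoise]
  rcases lt_or_ge x (Real.pi / 2) with h | h
  · have hc : ContinuousOn (invTortoise M k) (Icc 0 (3 * M)⁻¹) := fun u hu =>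
      (hasDerivAt_invTortoise hM hk (two_mul_lt_one_of_le hM hu.2)).continuousAt.continuousWithinAt
    have hx1 := hx.1
    rw [rStar3M_eq hM hk] at hx1
    obtain ⟨u, hu, hux⟩ := intermediate_value_Icc h3.le hc
      (show Real.pi / 2 - x ∈ _ from ⟨by rw [hG0]; linarith, by linarith⟩)
    have hu0 : 0 < u := by
      refine lt_of_le_of_ne hu.1 ?_
      rintro rfl
      rw [hG0] at hux
      linarith
    have hr : ∃ r ∈ Ici (3 * M), tortoise M k r = x := by
      have h4 : 3 * M ≤ u⁻¹ := (le_inv_comm₀ (by positivity) hu0).2 hu.2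
      exact ⟨u⁻¹, h4, by rw [tortoise_eq hM hk h4, inv_inv, hux]; ring⟩
    have hm : 3 * M ≤ radius M k x := Function.invFunOn_mem hr
    have he : tortoise M k (radius M k x) = x := Function.invFunOn_eq hr
    rw [invRadius, if_pos h]
    have hp : 0 < radius M k x := by linarith
    refine ⟨⟨(inv_pos.2 hp).le, inv_anti₀ (by positivity) hm⟩, ?_⟩
    rw [tortoise_eq hM hk hm] at he
    linarith
  · rw [invRadius, if_neg (not_lt.2 h), hG0]
    exact ⟨⟨le_rfl, h3.le⟩, by linarith [hx.2]⟩

theorem potential_eq (hM : 0 < M) (hk : 0 < k) (ℓ : ℕ) {x : ℝ} (hx : x ∈ interval M k) :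
    potential M k ℓ x = invWeight M k (invRadius M k x) * (ang ℓ - 6 * M * invRadius M k x) := by
  unfold potential
  split_ifs with h
  · have h1 := (invRadius_spec hM hk hx)
    have h2 : invRadius M k x = (radius M k x)⁻¹ := by rw [invRadius, if_pos h]
    have h3 : invRadius M k x ≠ 0 := by
      intro h0
      rw [h0] at h1
      simp only [invTortoise, intervalIntegral.integral_same] at h1
      linarith [h1.2]
    have h4 : 0 < radius M k x := by
      rw [← inv_pos, ← h2]
      exact lt_of_le_of_ne h1.1.1 (Ne.symm h3)
    rw [weight_eq_invWeight h4, h2]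
    rfl
  · rw [invRadius, if_neg h, invWeight]
    ring

/-- On [0, 1/(3M)] the weight is at most `Q`, so `invTortoise` has slope at least 1/`Q` and its
inverse is `Q`-Lipschitz. -/
theorem continuousOn_invRadius (hM : 0 < M) (hk : 0 < k) :
    ContinuousOn (invRadius M k) (interval M k) := by
  have h3 : (0 : ℝ) < (3 * M)⁻¹ := by positivity
  set Q := k ^ 2 + ((3 * M)⁻¹) ^ 2 with hQ
  have hQ0 : 0 < Q := by positivity
  have hexp : ∀ u ∈ Icc 0 (3 * M)⁻¹, ∀ v ∈ Icc 0 (3 * M)⁻¹, u ≤ v →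
      Q⁻¹ * (v - u) ≤ invTortoise M k v - invTortoise M k u := by
    refine (convex_Icc _ _).mul_sub_le_image_sub_of_le_deriv (fun u hu =>
      (hasDerivAt_invTortoise hM hk (two_mul_lt_one_of_le hM hu.2)).continuousAt.continuousWithinAt)
      (fun u hu => ?_) (fun u hu => ?_)
    · rw [interior_Icc] at hu
      exact (hasDerivAt_invTortoise hM hk
        (two_mul_lt_one_of_le hM hu.2.le)).differentiableAt.differentiableWithinAt
    · rw [interior_Icc] at hu
      have h := two_mul_lt_one_of_le hM hu.2.le
      rw [(hasDerivAt_invTortoise hM hk h).deriv]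
      apply inv_anti₀ (invWeight_pos hk h)
      have h5 : u ^ 2 ≤ ((3 * M)⁻¹) ^ 2 := pow_le_pow_left₀ hu.1.le hu.2.le 2
      have h6 : 0 < 2 * M * u ^ 3 := by have := hu.1; positivity
      unfold invWeight
      linarith
  have hlip : LipschitzOnWith Q.toNNReal (invRadius M k) (interval M k) := by
    refine LipschitzOnWith.of_dist_le_mul fun x hx y hy => ?_
    rw [Real.coe_toNNReal _ hQ0.le, Real.dist_eq, Real.dist_eq]
    obtain ⟨hx1, hx2⟩ := invRadius_spec hM hk hx
    obtain ⟨hy1, hy2⟩ := invRadius_spec hM hk hy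
    rw [← inv_mul_le_iff₀ hQ0]
    rcases le_total (invRadius M k x) (invRadius M k y) with h | h
    · have := hexp _ hx1 _ hy1 h
      rw [abs_sub_comm, abs_of_nonneg (sub_nonneg.2 h)]
      rw [hx2, hy2] at this
      exact (this.trans_eq (by ring)).trans (le_abs_self _)
    · have := hexp _ hy1 _ hx1 h
      rw [abs_of_nonneg (sub_nonneg.2 h), abs_sub_comm]
      rw [hx2, hy2] at this
      exact (this.trans_eq (by ring)).trans (le_abs_self _)
  exact hlip.continuousOn

/-- The inverse function rule is used relative to the interval, so it also covers both ends, in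
particular r = ∞. -/
theorem hasDerivWithinAt_invRadius (hM : 0 < M) (hk : 0 < k) {x : ℝ} (hx : x ∈ interval M k) :
    HasDerivWithinAt (invRadius M k) (-invWeight M k (invRadius M k x)) (interval M k) x := by
  have h1 := (invRadius_spec hM hk hx).1
  have h2 := two_mul_lt_one_of_le hM h1.2
  have hd : HasDerivAt (fun u => Real.pi / 2 - invTortoise M k u)
      (-(invWeight M k (invRadius M k x))⁻¹) (invRadius M k x) := by
    simpa using (hasDerivAt_invTortoise hM hk h2).const_sub (Real.pi / 2)
  have hne : -(invWeight M k (invRadius M k x))⁻¹ ≠ 0 :=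
    neg_ne_zero.2 (inv_ne_zero (invWeight_pos hk h2).ne')
  have h3 := (hd.hasFDerivAt_equiv hne).hasFDerivWithinAt (s := univ)
  have h4 := HasFDerivWithinAt.of_local_left_inverse (g := invRadius M k) (a := x)
    (s := interval M k) (by
      rw [nhdsWithin_univ]
      exact continuousOn_invRadius hM hk x hx) h3 hx (by
      filter_upwards [self_mem_nhdsWithin] with y hy
      rw [(invRadius_spec hM hk hy).2]
      ring)
  have h5 := h4.hasDerivWithinAt
  simpa using h5

theorem uniqueDiffOn_interval (hM : 0 < M) (hk : 0 < k) : UniqueDiffOn ℝ (interval M k) :=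
  uniqueDiffOn_Icc (rStar3M_lt hM hk)

theorem contDiffOn_potential (hM : 0 < M) (hk : 0 < k) (ℓ : ℕ) :
    ContDiffOn ℝ (⊤ : ℕ∞) (potential M k ℓ) (interval M k) := by
  have h1 : ContDiffOn ℝ (⊤ : ℕ∞) (invRadius M k) (interval M k) :=
    contDiffOn_of_autonomous (p := fun v => -invWeight M k v) (uniqueDiffOn_interval hM hk)
      contDiff_invWeight.neg fun x hx => hasDerivWithinAt_invRadius hM hk hx
  refine ContDiffOn.congr ?_ fun x hx => potential_eq hM hk ℓ hx
  exact (contDiff_invWeight.comp_contDiffOn h1).mul (contDiffOn_const.sub (contDiffOn_const.mul h1))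

theorem six_le_ang {ℓ : ℕ} (hℓ : 2 ≤ ℓ) : 6 ≤ ang ℓ := by
  have : (2 : ℝ) ≤ ℓ := by exact_mod_cast hℓ
  unfold ang
  nlinarith

theorem potential_nonneg (hM : 0 < M) (hk : 0 < k) {ℓ : ℕ} (hℓ : 2 ≤ ℓ) {x : ℝ}
    (hx : x ∈ interval M k) : 0 ≤ potential M k ℓ x := by
  have h1 := (invRadius_spec hM hk hx).1
  have h2 := two_mul_lt_one_of_le hM h1.2
  rw [potential_eq hM hk ℓ hx]
  have := six_le_ang hℓ
  exact mul_nonneg (invWeight_pos hk h2).le (by linarith)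

end Tortoise

/-! ### The space `H¹₀((α, β])` -/

section Sobolev

variable {α β : ℝ}

/-- The weak derivative as a continuous linear map into `L²`. -/
def weakDeriv (α β : ℝ) : H10 α β →L[ℝ] Lp ℝ 2 (vol α β) :=
  (WithLp.sndL 2 ℝ (Lp ℝ 2 (vol α β)) (Lp ℝ 2 (vol α β))) ∘L
    (testSpace α β).topologicalClosure.subtypeL

theorem weakDeriv_apply (u : H10 α β) : weakDeriv α β u = (u : Ambient α β).snd := rfl

theorem coeFn_weakDeriv (u : H10 α β) : (weakDeriv α β u : ℝ → ℝ) = dfn u := rfl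

theorem dfn_add (u v : H10 α β) : dfn (u + v) =ᵐ[vol α β] dfn u + dfn v := by
  simp only [← coeFn_weakDeriv, map_add]
  exact Lp.coeFn_add _ _

theorem dfn_smul (c : ℝ) (u : H10 α β) : dfn (c • u) =ᵐ[vol α β] c • dfn u := by
  simp only [← coeFn_weakDeriv, map_smul]
  exact Lp.coeFn_smul _ _

theorem intervalIntegrable_dfn (u : H10 α β) {x y : ℝ} (hx : x ∈ Icc α β) (hy : y ∈ Icc α β) :
    IntervalIntegrable (dfn u) volume x y := by
  have h : IntegrableOn (dfn u) (Icc α β) :=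
    (integrableOn_Icc_iff_integrableOn_Ioo).2 (integrableOn_dfn u)
  exact (h.mono_set (uIcc_subset_Icc hx hy)).intervalIntegrable

theorem ae_restrict_Ioc_of_ae_vol {p : ℝ → Prop} (h : ∀ᵐ x ∂(vol α β), p x) {x y : ℝ}
    (hx : x ∈ Icc α β) (hy : y ∈ Icc α β) : ∀ᵐ t ∂(volume.restrict (uIoc x y)), p t := by
  rw [vol, Measure.restrict_congr_set Ioo_ae_eq_Ioc] at h
  refine ae_restrict_of_ae_restrict_of_subset (fun t ht => ?_) h
  have h1 := uIoc_subset_uIcc ht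
  have h2 : min x y < t := ht.1
  exact ⟨lt_of_le_of_lt (le_min hx.1 hy.1) h2, (uIcc_subset_Icc hx hy h1).2⟩

theorem intervalIntegral_congr_vol {f g : ℝ → ℝ} (h : f =ᵐ[vol α β] g) {x y : ℝ}
    (hx : x ∈ Icc α β) (hy : y ∈ Icc α β) : ∫ t in x..y, f t = ∫ t in x..y, g t := by
  apply intervalIntegral.integral_congr_ae
  exact (ae_restrict_iff' measurableSet_uIoc).1 (ae_restrict_Ioc_of_ae_vol h hx hy)

theorem rep_left (u : H10 α β) : rep u α = 0 := by simp [rep]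

theorem rep_add (u v : H10 α β) {x : ℝ} (hx : x ∈ Icc α β) :
    rep (u + v) x = rep u x + rep v x := by
  have hα : α ∈ Icc α β := ⟨le_rfl, hx.1.trans hx.2⟩
  rw [rep, rep, rep, intervalIntegral_congr_vol (dfn_add u v) hα hx]
  exact intervalIntegral.integral_add (intervalIntegrable_dfn u hα hx)
    (intervalIntegrable_dfn v hα hx)

theorem rep_smul (c : ℝ) (u : H10 α β) {x : ℝ} (hx : x ∈ Icc α β) :
    rep (c • u) x = c * rep u x := by
  have hα : α ∈ Icc α β := ⟨le_rfl, hx.1.trans hx.2⟩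
  rw [rep, rep, intervalIntegral_congr_vol (dfn_smul c u) hα hx]
  exact intervalIntegral.integral_const_mul c _

theorem rep_sub_rep (u : H10 α β) {x y : ℝ} (hx : x ∈ Icc α β) (hy : y ∈ Icc α β) :
    rep u y - rep u x = ∫ t in x..y, dfn u t := by
  have hα : α ∈ Icc α β := ⟨le_rfl, hx.1.trans hx.2⟩
  exact intervalIntegral.integral_interval_sub_left (intervalIntegrable_dfn u hα hy)
    (intervalIntegrable_dfn u hα hx)

/-- Cauchy–Schwarz against the indicator of (x, y). -/
theorem abs_integral_dfn_le (u : H10 α β) {x y : ℝ} (hx : α ≤ x) (hxy : x ≤ y) (hy : y ≤ β) :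
    |∫ t in x..y, dfn u t| ≤ √(y - x) * ‖weakDeriv α β u‖ := by
  have hsub : Ioo x y ⊆ Ioo α β := Ioo_subset_Ioo hx hy
  have h1 : ∫ t in x..y, dfn u t =
      inner ℝ (indicatorConstLp 2 (measurableSet_Ioo (a := x) (b := y))
        (measure_ne_top (vol α β) _) (1 : ℝ)) (weakDeriv α β u) := by
    rw [L2.inner_indicatorConstLp_one, intervalIntegral.integral_of_le hxy,
      integral_Ioc_eq_integral_Ioo, Measure.restrict_restrict measurableSet_Ioo,
      inter_eq_left.2 hsub]
    rfl
  rw [h1]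
  refine (abs_real_inner_le_norm _ _).trans_eq ?_
  rw [norm_indicatorConstLp (by simp) (by simp), Measure.real,
    Measure.restrict_apply measurableSet_Ioo, inter_eq_left.2 hsub, Real.volume_Ioo,
    ENNReal.toReal_ofReal (sub_nonneg.2 hxy), Real.sqrt_eq_rpow]
  simp

theorem abs_rep_sub_rep_le (u : H10 α β) {x y : ℝ} (hx : x ∈ Icc α β) (hy : y ∈ Icc α β) :
    |rep u x - rep u y| ≤ √|x - y| * ‖weakDeriv α β u‖ := by
  rcases le_total x y with h | h
  · rw [abs_sub_comm, abs_sub_comm x y, rep_sub_rep u hx hy, abs_of_nonneg (sub_nonneg.2 h)]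
    exact abs_integral_dfn_le u hx.1 h hy.2
  · rw [rep_sub_rep u hy hx, abs_of_nonneg (sub_nonneg.2 h)]
    exact abs_integral_dfn_le u hy.1 h hx.2

theorem abs_rep_le (u : H10 α β) {x : ℝ} (hx : x ∈ Icc α β) :
    |rep u x| ≤ √(β - α) * ‖weakDeriv α β u‖ := by
  refine (abs_integral_dfn_le u le_rfl hx.1 hx.2).trans ?_
  gcongr
  exact hx.2

/-- Poincaré inequality: vanishing at α bounds the function uniformly by its derivative in L². It
yields both coercivity of the energy and closed range of `weakDeriv`. -/
theorem norm_le_weakDeriv (hαβ : α ≤ β) (u : H10 α β) :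
    ‖u‖ ≤ (β - α + 1) * ‖weakDeriv α β u‖ := by
  have h1 : ‖(u : Ambient α β).fst‖ ≤ (β - α) * ‖weakDeriv α β u‖ := by
    have h2 : ∀ᵐ x ∂(vol α β), ‖((u : Ambient α β).fst : ℝ → ℝ) x‖
        ≤ √(β - α) * ‖weakDeriv α β u‖ := by
      filter_upwards [rep_ae u, ae_restrict_mem measurableSet_Ioo] with x hx hx2
      have : ((u : Ambient α β).fst : ℝ → ℝ) x = rep u x := hx
      rw [this]
      exact abs_rep_le u (Ioo_subset_Icc_self hx2)
    refine (Lp.norm_le_of_ae_bound (by positivity) h2).trans_eq ?_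
    have h3 : (measureUnivNNReal (vol α β) : ℝ) = β - α := by
      rw [measureUnivNNReal, Measure.restrict_apply_univ, Real.volume_Ioo]
      exact ENNReal.toReal_ofReal (sub_nonneg.2 hαβ)
    rw [h3, ← mul_assoc]
    congr 1
    have h4 : (ENNReal.toReal 2)⁻¹ = (1 / 2 : ℝ) := by norm_num
    rw [h4, ← Real.sqrt_eq_rpow]
    exact Real.mul_self_sqrt (sub_nonneg.2 hαβ)
  have h5 : ‖u‖ ^ 2 = ‖(u : Ambient α β).fst‖ ^ 2 + ‖weakDeriv α β u‖ ^ 2 := by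
    rw [weakDeriv_apply, ← WithLp.prod_norm_sq_eq_of_L2]
    rfl
  have h6 : 0 ≤ ‖(u : Ambient α β).fst‖ := norm_nonneg _
  have h7 : 0 ≤ ‖weakDeriv α β u‖ := norm_nonneg _
  have h8 : ‖u‖ ≤ ‖(u : Ambient α β).fst‖ + ‖weakDeriv α β u‖ := by
    apply le_of_sq_le_sq _ (by positivity)
    nlinarith [mul_nonneg h6 h7]
  linarith

theorem IsTest.memLp {φ : ℝ → ℝ} (h : IsTest α φ) : MemLp φ 2 (vol α β) :=
  h.smooth.continuous.memLp_of_hasCompactSupport h.compact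

theorem IsTest.memLp_deriv {φ : ℝ → ℝ} (h : IsTest α φ) : MemLp (deriv φ) 2 (vol α β) :=
  (h.smooth.continuous_deriv (by simp)).memLp_of_hasCompactSupport h.compact.deriv

/-- The element of `H¹₀((α, β])` given by a test function. -/
def ofTest (α β : ℝ) {φ : ℝ → ℝ} (h : IsTest α φ) : H10 α β :=
  ⟨WithLp.toLp 2 (h.memLp.toLp φ, h.memLp_deriv.toLp (deriv φ)),
    (testSpace α β).le_topologicalClosure
      ⟨φ, h, MemLp.coeFn_toLp h.memLp, MemLp.coeFn_toLp h.memLp_deriv⟩⟩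

theorem dfn_ofTest {φ : ℝ → ℝ} (h : IsTest α φ) : dfn (ofTest α β h) =ᵐ[vol α β] deriv φ :=
  MemLp.coeFn_toLp h.memLp_deriv

/-- The primitive of `g` from α vanishes near α but may be a nonzero constant from β on; since
nothing is imposed at β, a cutoff beyond β makes it a test function. -/
theorem exists_isTest_deriv_eq (hαβ : α < β) {g : ℝ → ℝ} (hg : ContDiff ℝ (⊤ : ℕ∞) g)
    (hgc : HasCompactSupport g) (hgs : tsupport g ⊆ Ioo α β) :
    ∃ φ, IsTest α φ ∧ ∀ x ∈ Ioo α β, deriv φ x = g x := by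
  obtain ⟨a, ha, hga⟩ : ∃ a > α, ∀ x < a, g x = 0 := by
    rcases (tsupport g).eq_empty_or_nonempty with h | h
    · refine ⟨α + 1, by linarith, fun x _ => ?_⟩
      rw [tsupport_eq_empty_iff.1 h]
      rfl
    · obtain ⟨a, ha⟩ := hgc.isCompact.exists_isLeast h
      refine ⟨a, (hgs ha.1).1, fun x hx => ?_⟩
      by_contra hne
      exact absurd (ha.2 (subset_tsupport _ hne)) (not_le.2 hx)
  set ψ : ℝ → ℝ := fun x => ∫ t in α..x, g t with hψ
  have hψd : ∀ x, HasDerivAt ψ (g x) x := fun x =>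
    intervalIntegral.integral_hasDerivAt_right (hg.continuous.intervalIntegrable _ _)
      hg.continuous.stronglyMeasurable.stronglyMeasurableAtFilter hg.continuous.continuousAt
  have hψs : ContDiff ℝ (⊤ : ℕ∞) ψ := by
    rw [contDiff_infty_iff_deriv]
    refine ⟨fun x => (hψd x).differentiableAt, ?_⟩
    rwa [show deriv ψ = g from funext fun x => (hψd x).deriv]
  have hψ0 : ∀ x < a, ψ x = 0 := fun x hx => by
    apply intervalIntegral.integral_zero_ae
    refine Filter.Eventually.of_forall fun t ht => hga t ?_
    exact lt_of_le_of_lt ht.2 (max_lt ha hx)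
  -- The inner radius exceeds β - α, so the cutoff equals 1 on all of (α, β).
  let χ : ContDiffBump β := ⟨β - α + 1, β - α + 2, by linarith, by linarith⟩
  refine ⟨fun x => χ x * ψ x, ⟨?_, ?_, ?_⟩, fun x hx => ?_⟩
  · exact χ.contDiff.mul hψs
  · exact χ.hasCompactSupport.mul_right
  · refine (closure_minimal (fun x hx => ?_) isClosed_Ici).trans (Ici_subset_Ioi.2 ha)
    by_contra h
    exact hx (by simp [hψ0 x (not_le.1 h)])
  · have h1 : (fun x => χ x * ψ x) =ᶠ[nhds x] ψ := by
      filter_upwards [Ioo_mem_nhds hx.1 hx.2] with y hy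
      rw [χ.one_of_mem_closedBall, one_mul]
      rw [Metric.mem_closedBall, Real.dist_eq, abs_sub_comm, abs_of_nonneg (by linarith [hy.2])]
      change β - y ≤ β - α + 1
      linarith [hy.1]
    rw [h1.deriv_eq, (hψd x).deriv]

/-- The range is closed by Poincaré, and it contains every smooth function compactly supported in
(α, β), so its orthogonal complement is zero. Any L² function may therefore serve as v' in the weak
equation. -/
theorem weakDeriv_surjective (hαβ : α < β) : Function.Surjective (weakDeriv α β) := by
  have hclosed : IsClosed (((weakDeriv α β).range : Submodule ℝ _) : Set (Lp ℝ 2 (vol α β))) := by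
    have h := (weakDeriv α β).antilipschitz_of_bound (K := (β - α + 1).toNNReal) fun u => by
      rw [Real.coe_toNNReal _ (by linarith)]
      exact norm_le_weakDeriv hαβ.le u
    exact h.isClosed_range (weakDeriv α β).uniformContinuous
  have horth : (weakDeriv α β).rangeᗮ = ⊥ := by
    rw [Submodule.eq_bot_iff]
    intro w hw
    rw [Submodule.mem_orthogonal] at hw
    have hwint : IntegrableOn w (Ioo α β) := (Lp.memLp w).integrable one_le_two
    have h0 := isOpen_Ioo.ae_eq_zero_of_integral_contDiff_smul_eq_zero (U := Ioo α β) (f := w)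
      (μ := volume) hwint.locallyIntegrableOn (fun g hg hgc hgs => by
        obtain ⟨φ, hφ, hφg⟩ := exists_isTest_deriv_eq hαβ hg hgc hgs
        have h1 := hw _ ⟨ofTest α β hφ, rfl⟩
        rw [L2.inner_def] at h1
        rw [← setIntegral_eq_integral_of_forall_compl_eq_zero (s := Ioo α β) (fun x hx => by
          rw [image_eq_zero_of_notMem_tsupport fun h => hx (hgs h), zero_smul]), ← h1]
        apply integral_congr_ae
        filter_upwards [dfn_ofTest (β := β) hφ, ae_restrict_mem measurableSet_Ioo] with x hx hx2
        have h2 : (weakDeriv α β (ofTest α β hφ) : ℝ → ℝ) x = g x := by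
          rw [← hφg x hx2, ← hx]
          rfl
        change _ = inner ℝ ((weakDeriv α β (ofTest α β hφ) : ℝ → ℝ) x) (w x)
        rw [h2]
        simp [mul_comm])
    rw [Lp.eq_zero_iff_ae_eq_zero]
    exact (ae_restrict_iff' measurableSet_Ioo).2 h0
  have hK : CompleteSpace (weakDeriv α β).range := hclosed.completeSpace_coe
  have htop : (weakDeriv α β).range = ⊤ := by
    rw [← Submodule.orthogonal_orthogonal (weakDeriv α β).range, horth,
      Submodule.bot_orthogonal_eq_top]
  exact LinearMap.range_eq_top.1 htop

theorem exists_dfn_eq (hαβ : α < β) {w : ℝ → ℝ} (hw : MemLp w 2 (vol α β)) :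
    ∃ u : H10 α β, dfn u =ᵐ[vol α β] w := by
  obtain ⟨u, hu⟩ := weakDeriv_surjective hαβ (hw.toLp w)
  refine ⟨u, ?_⟩
  rw [← coeFn_weakDeriv, hu]
  exact hw.coeFn_toLp

theorem memLp_two_of_continuousOn {w : ℝ → ℝ} (hw : ContinuousOn w (Icc α β)) :
    MemLp w 2 (vol α β) := by
  obtain ⟨C, hC⟩ := isCompact_Icc.exists_bound_of_continuousOn hw
  refine MemLp.of_bound ?_ C ?_
  · exact (hw.mono Ioo_subset_Icc_self).aestronglyMeasurable measurableSet_Ioo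
  · filter_upwards [ae_restrict_mem measurableSet_Ioo] with x hx
    exact hC x (Ioo_subset_Icc_self hx)

/-- The space maps onto L², which contains a copy of the polynomials. -/
theorem not_finiteDimensional_H10 (hαβ : α < β) : ¬ FiniteDimensional ℝ (H10 α β) := by
  intro hfin
  have hmem : ∀ p : Polynomial ℝ, MemLp (fun x => p.eval x) 2 (vol α β) := fun p =>
    memLp_two_of_continuousOn p.continuous.continuousOn
  let L : Polynomial ℝ →ₗ[ℝ] Lp ℝ 2 (vol α β) :=
    { toFun := fun p => (hmem p).toLp _
      map_add' := fun p q => by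
        rw [← MemLp.toLp_add]
        congr 1
        funext x
        simp
      map_smul' := fun c p => by
        rw [RingHom.id_apply, ← MemLp.toLp_const_smul]
        congr 1
        funext x
        simp }
  have hL : Function.Injective L := by
    rw [← LinearMap.ker_eq_bot, LinearMap.ker_eq_bot']
    intro p hp
    have h1 : (fun x => p.eval x) =ᵐ[vol α β] 0 := by
      have h2 := (hmem p).coeFn_toLp
      rw [show (hmem p).toLp _ = (0 : Lp ℝ 2 (vol α β)) from hp] at h2
      exact h2.symm.trans (Lp.coeFn_zero _ _ _)
    have h3 : EqOn (fun x => p.eval x) (fun _ => 0) (Ioo α β) :=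
      Measure.eqOn_open_of_ae_eq h1 isOpen_Ioo p.continuous.continuousOn continuousOn_const
    exact p.eq_zero_of_infinite_isRoot ((Ioo_infinite hαβ).mono fun x hx => h3 hx)
  have hfin2 : FiniteDimensional ℝ (Lp ℝ 2 (vol α β)) :=
    Module.Finite.of_surjective (weakDeriv α β).toLinearMap (weakDeriv_surjective hαβ)
  exact Polynomial.not_finite (Module.Finite.of_injective L hL)

/-! ### The compact embedding into the continuous functions -/

open scoped BoundedContinuousFunction

/-- The embedding of `H¹₀((α, β])` into the continuous functions on `[α, β]`. -/
def toContinuous (α β : ℝ) : H10 α β →L[ℝ] (Icc α β →ᵇ ℝ) :=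
  LinearMap.mkContinuous
    { toFun := fun u => BoundedContinuousFunction.mkOfCompact
        ⟨(Icc α β).domRestrict (rep u), (rep_continuousOn u).domRestrict⟩
      map_add' := fun u v => by
        ext x
        exact rep_add u v x.2
      map_smul' := fun c u => by
        ext x
        exact rep_smul c u x.2 }
    (√(β - α) * ‖weakDeriv α β‖) fun u => by
      rw [BoundedContinuousFunction.norm_le (by positivity)]
      intro x
      refine (abs_rep_le u x.2).trans ?_
      rw [mul_assoc]
      gcongr
      exact (weakDeriv α β).le_opNorm u

@[simp]
theorem toContinuous_apply (u : H10 α β) (x : Icc α β) : toContinuous α β u x = rep u x := rfl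

/-- Arzelà–Ascoli: the unit ball is uniformly bounded and uniformly Hölder of exponent 1/2. -/
theorem isCompactOperator_toContinuous : IsCompactOperator (toContinuous α β) := by
  rw [isCompactOperator_iff_exists_mem_nhds_isCompact_closure_image]
  refine ⟨Metric.closedBall 0 1, Metric.closedBall_mem_nhds _ one_pos, ?_⟩
  set C := ‖weakDeriv α β‖ with hC
  have hu : ∀ u ∈ Metric.closedBall (0 : H10 α β) 1, ‖weakDeriv α β u‖ ≤ C := fun u hu => by
    refine (weakDeriv α β).le_of_opNorm_le_of_le le_rfl (by simpa using hu) |>.trans_eq ?_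
    rw [mul_one]
  refine BoundedContinuousFunction.arzela_ascoli (Metric.closedBall 0 (√(β - α) * C))
    (isCompact_closedBall _ _) _ ?_ ?_
  · rintro _ x ⟨u, hu1, rfl⟩
    rw [mem_closedBall_zero_iff, toContinuous_apply]
    refine (abs_rep_le u x.2).trans ?_
    gcongr
    exact hu u hu1
  · refine Metric.equicontinuous_of_continuity_modulus (fun s => √|s| * C) ?_ _ ?_
    · have : Continuous fun s : ℝ => √|s| * C := by fun_prop
      simpa using this.tendsto 0
    · rintro x y ⟨_, u, hu1, rfl⟩
      change dist (rep u x) (rep u y) ≤ _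
      rw [Real.dist_eq, Subtype.dist_eq, Real.dist_eq, abs_abs]
      refine (abs_rep_sub_rep_le u x.2 y.2).trans ?_
      gcongr
      exact hu u hu1

/-! ### Integration by parts -/

/-- The factors are only integrable, so this is the product rule for absolutely continuous
primitives, differentiated almost everywhere. -/
theorem integral_primitive_mul_add {f g : ℝ → ℝ} (hf : IntervalIntegrable f volume α β)
    (hg : IntervalIntegrable g volume α β) :
    ∫ x in α..β, (f x * (∫ t in α..x, g t) + (∫ t in α..x, f t) * g x)
      = (∫ t in α..β, f t) * ∫ t in α..β, g t := by
  have h1 := (hf.absolutelyContinuousOnInterval_intervalIntegral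
    (left_mem_uIcc)).integral_deriv_mul_eq_sub
    (hg.absolutelyContinuousOnInterval_intervalIntegral left_mem_uIcc)
  simp only [intervalIntegral.integral_same, mul_zero, sub_zero] at h1
  rw [← h1]
  apply intervalIntegral.integral_congr_ae
  filter_upwards [hf.ae_hasDerivAt_integral, hg.ae_hasDerivAt_integral] with x hx1 hx2 hx
  have hx' := uIoc_subset_uIcc hx
  rw [(hx1 hx' α left_mem_uIcc).deriv, (hx2 hx' α left_mem_uIcc).deriv]

end Sobolev

/-! ### Bilinear forms on `H¹₀((α, β])` -/

section Forms

open scoped BoundedContinuousFunction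

variable {α β : ℝ}

theorem setIntegral_Ioo_eq (hαβ : α ≤ β) (f : ℝ → ℝ) :
    ∫ x in Ioo α β, f x = ∫ x in α..β, f x := by
  rw [intervalIntegral.integral_of_le hαβ, integral_Ioc_eq_integral_Ioo]

theorem integrableOn_Ioo_of_continuousOn {f : ℝ → ℝ} (hf : ContinuousOn f (Icc α β)) :
    IntegrableOn f (Ioo α β) :=
  (hf.integrableOn_Icc).mono_set Ioo_subset_Icc_self

theorem integrableOn_dfn_mul_dfn (u v : H10 α β) :
    IntegrableOn (fun x => dfn u x * dfn v x) (Ioo α β) :=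
  (Lp.memLp (weakDeriv α β u)).integrable_mul (Lp.memLp (weakDeriv α β v))

/-- The Dirichlet form `∫ u' v'`. -/
def dirichletForm (u v : H10 α β) : ℝ := ∫ x in Ioo α β, dfn u x * dfn v x

/-- The form `∫ ρ u v + κ u(β) v(β)`. -/
def massForm (ρ : ℝ → ℝ) (κ : ℝ) (u v : H10 α β) : ℝ :=
  (∫ x in Ioo α β, ρ x * rep u x * rep v x) + κ * rep u β * rep v β

theorem dirichletForm_eq_inner (u v : H10 α β) :
    dirichletForm u v = inner ℝ (weakDeriv α β u) (weakDeriv α β v) := by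
  rw [L2.inner_def]
  apply integral_congr_ae
  filter_upwards with x
  simp [coeFn_weakDeriv, mul_comm]

theorem dirichletForm_comm (u v : H10 α β) : dirichletForm u v = dirichletForm v u := by
  simp only [dirichletForm, mul_comm]

theorem massForm_comm (ρ : ℝ → ℝ) (κ : ℝ) (u v : H10 α β) :
    massForm ρ κ u v = massForm ρ κ v u := by
  simp only [massForm, mul_assoc, mul_comm (rep u _)]

/-- The form `∫ ρ f g + κ f(β) g(β)` on the continuous functions on `[α, β]`. -/
def continuousMassForm (hαβ : α ≤ β) {ρ : ℝ → ℝ} (hρ : ContinuousOn ρ (Icc α β)) (κ : ℝ) :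
    (Icc α β →ᵇ ℝ) →L[ℝ] (Icc α β →ᵇ ℝ) →L[ℝ] ℝ :=
  have hint : ∀ f g : Icc α β →ᵇ ℝ,
      IntegrableOn (fun x => ρ x * f (projIcc α β hαβ x) * g (projIcc α β hαβ x)) (Ioo α β) :=
    fun f g => integrableOn_Ioo_of_continuousOn ((hρ.mul
      (f.continuous.comp continuous_projIcc).continuousOn).mul
      (g.continuous.comp continuous_projIcc).continuousOn)
  LinearMap.mkContinuous₂
    (LinearMap.mk₂ ℝ
      (fun f g => (∫ x in Ioo α β, ρ x * f (projIcc α β hαβ x) * g (projIcc α β hαβ x))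
        + κ * f ⟨β, right_mem_Icc.2 hαβ⟩ * g ⟨β, right_mem_Icc.2 hαβ⟩)
      (fun f₁ f₂ g => by
        simp only [BoundedContinuousFunction.add_apply, mul_add, add_mul]
        rw [integral_add (hint f₁ g) (hint f₂ g)]
        ring)
      (fun c f g => by
        simp only [BoundedContinuousFunction.smul_apply, smul_eq_mul]
        rw [mul_add, ← integral_const_mul]
        congr 1
        · congr 1
          funext x
          ring
        · ring)
      (fun f g₁ g₂ => by
        simp only [BoundedContinuousFunction.add_apply, mul_add]
        rw [integral_add (hint f g₁) (hint f g₂)]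
        ring)
      (fun c f g => by
        simp only [BoundedContinuousFunction.smul_apply, smul_eq_mul]
        rw [mul_add, ← integral_const_mul]
        congr 1
        · congr 1
          funext x
          ring
        · ring))
    ((∫ x in Ioo α β, |ρ x|) + |κ|) (fun f g => by
      rw [LinearMap.mk₂_apply, add_mul, add_mul]
      refine (norm_add_le _ _).trans (add_le_add ?_ ?_)
      · rw [← integral_mul_const, ← integral_mul_const]
        refine norm_integral_le_of_norm_le
          (((integrableOn_Ioo_of_continuousOn hρ).abs.mul_const _).mul_const _)
          (Filter.Eventually.of_forall fun x => ?_)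
        rw [norm_mul, norm_mul, Real.norm_eq_abs (ρ x)]
        gcongr
        · exact f.norm_coe_le_norm _
        · exact g.norm_coe_le_norm _
      · rw [norm_mul, norm_mul, Real.norm_eq_abs κ]
        gcongr
        · exact f.norm_coe_le_norm _
        · exact g.norm_coe_le_norm _)

theorem exists_massForm (hαβ : α ≤ β) {ρ : ℝ → ℝ} (hρ : ContinuousOn ρ (Icc α β)) (κ : ℝ) :
    ∃ b : H10 α β →L[ℝ] H10 α β →L[ℝ] ℝ, (∀ u v, b u v = massForm ρ κ u v) ∧
      IsCompactOperator b := by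
  set P := continuousMassForm hαβ hρ κ with hP
  refine ⟨P.bilinearComp (toContinuous α β) (toContinuous α β), fun u v => ?_, ?_⟩
  · change (∫ x in Ioo α β, ρ x * rep u (projIcc α β hαβ x) * rep v (projIcc α β hαβ x))
      + κ * rep u β * rep v β = _
    rw [massForm]
    congr 1
    refine setIntegral_congr_fun measurableSet_Ioo fun x hx => ?_
    simp only [projIcc_of_mem hαβ (Ioo_subset_Icc_self hx)]
  · have h1 : IsCompactOperator (P ∘L toContinuous α β) :=
      isCompactOperator_toContinuous.clm_comp P
    exact h1.continuous_comp
      (g := fun φ : (Icc α β →ᵇ ℝ) →L[ℝ] ℝ => φ ∘L toContinuous α β)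
      (continuous_id.clm_comp_const _)

theorem massForm_self_nonneg {ρ : ℝ → ℝ} (hρ : ∀ x ∈ Icc α β, 0 ≤ ρ x) {κ : ℝ} (hκ : 0 ≤ κ)
    (u : H10 α β) : 0 ≤ massForm ρ κ u u := by
  refine add_nonneg (setIntegral_nonneg measurableSet_Ioo fun x hx => ?_) ?_
  · rw [mul_assoc]
    exact mul_nonneg (hρ x (Ioo_subset_Icc_self hx)) (mul_self_nonneg _)
  · rw [mul_assoc]
    exact mul_nonneg hκ (mul_self_nonneg _)

theorem exists_energyForm (hαβ : α ≤ β) {ρ : ℝ → ℝ} (hρ : ContinuousOn ρ (Icc α β))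
    (hρ0 : ∀ x ∈ Icc α β, 0 ≤ ρ x) {κ : ℝ} (hκ : 0 ≤ κ) :
    ∃ B : H10 α β →L[ℝ] H10 α β →L[ℝ] ℝ,
      (∀ u v, B u v = dirichletForm u v + massForm ρ κ u v) ∧ IsCoercive B := by
  obtain ⟨b, hb, -⟩ := exists_massForm hαβ hρ κ
  obtain ⟨A, hA⟩ : ∃ A : H10 α β →L[ℝ] H10 α β →L[ℝ] ℝ,
      ∀ u v, A u v = inner ℝ (weakDeriv α β u) (weakDeriv α β v) :=
    ⟨(innerSL ℝ).bilinearComp (weakDeriv α β) (weakDeriv α β), fun _ _ => rfl⟩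
  refine ⟨A + b, ?_, ?_⟩
  · intro u v
    simp [hA, hb, dirichletForm_eq_inner]
  · have h0 : 0 < β - α + 1 := by linarith
    refine ⟨((β - α + 1) ^ 2)⁻¹, by positivity, fun u => ?_⟩
    have h1 := massForm_self_nonneg hρ0 hκ u
    have h2 := norm_le_weakDeriv hαβ u
    have h3 : ‖u‖ ^ 2 ≤ (β - α + 1) ^ 2 * ‖weakDeriv α β u‖ ^ 2 := by
      rw [← mul_pow]
      exact pow_le_pow_left₀ (norm_nonneg _) h2 2
    have h4 : ((A + b) u) u = ‖weakDeriv α β u‖ ^ 2 + massForm ρ κ u u := by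
      simp [hA, hb]
    rw [h4, mul_assoc, ← pow_two, inv_mul_le_iff₀ (by positivity)]
    have : 0 ≤ (β - α + 1) ^ 2 * massForm ρ κ u u := by positivity
    nlinarith

/-- By Lebesgue differentiation the weak derivative is almost everywhere the derivative of `rep u`,
hence zero; Poincaré concludes. -/
theorem eq_zero_of_rep_eq_zero (hαβ : α ≤ β) {u : H10 α β} (h : ∀ x ∈ Ioo α β, rep u x = 0) :
    u = 0 := by
  have hd : weakDeriv α β u = 0 := by
    rw [Lp.eq_zero_iff_ae_eq_zero]
    refine (ae_restrict_iff' measurableSet_Ioo).2 ?_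
    have hα : α ∈ Icc α β := left_mem_Icc.2 hαβ
    filter_upwards [(intervalIntegrable_dfn u hα (right_mem_Icc.2 hαβ)).ae_hasDerivAt_integral]
      with x hx hx2
    rw [uIcc_of_le hαβ] at hx
    have h1 := hx (Ioo_subset_Icc_self hx2) α hα
    have h2 : (fun x => ∫ t in α..x, dfn u t) =ᶠ[nhds x] fun _ => 0 := by
      filter_upwards [Ioo_mem_nhds hx2.1 hx2.2] with y hy
      exact h y hy
    exact (h1.congr_of_eventuallyEq h2.symm).unique (hasDerivAt_const x 0)
  have := norm_le_weakDeriv hαβ u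
  rw [hd, norm_zero, mul_zero] at this
  exact norm_le_zero_iff.1 this

theorem massForm_one_pos (hαβ : α ≤ β) {κ : ℝ} (hκ : 0 ≤ κ) {u : H10 α β} (hu : u ≠ 0) :
    0 < massForm (fun _ => 1) κ u u := by
  have h0 : 0 ≤ κ * rep u β * rep u β := by
    rw [mul_assoc]
    exact mul_nonneg hκ (mul_self_nonneg _)
  have h1 : 0 ≤ ∫ x in Ioo α β, 1 * rep u x * rep u x :=
    setIntegral_nonneg measurableSet_Ioo fun x _ => by
      rw [one_mul]
      exact mul_self_nonneg _
  refine lt_of_le_of_ne (add_nonneg h1 h0) fun heq => hu ?_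
  have h2 : ∫ x in Ioo α β, 1 * rep u x * rep u x = 0 := by
    rw [massForm] at heq
    linarith
  have hc := rep_continuousOn u
  have hint : IntegrableOn (fun x => 1 * rep u x * rep u x) (Ioo α β) :=
    integrableOn_Ioo_of_continuousOn ((continuousOn_const.mul hc).mul hc)
  rw [integral_eq_zero_iff_of_nonneg (fun x => by
      simp only [Pi.zero_apply, one_mul]
      exact mul_self_nonneg _) hint] at h2
  have h3 : rep u =ᵐ[vol α β] 0 := by
    filter_upwards [h2] with x hx
    simpa using hx
  exact eq_zero_of_rep_eq_zero hαβ (Measure.eqOn_open_of_ae_eq h3 isOpen_Ioo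
    (hc.mono Ioo_subset_Icc_self) continuousOn_const)

/-! ### Weak and classical solutions -/

theorem hasDerivWithinAt_primitive (hαβ : α ≤ β) {h : ℝ → ℝ} (hh : ContinuousOn h (Icc α β))
    {x : ℝ} (hx : x ∈ Icc α β) :
    HasDerivWithinAt (fun x => ∫ t in α..x, h t) (h x) (Icc α β) x := by
  have hc : Continuous (IccExtend hαβ ((Icc α β).domRestrict h)) := hh.domRestrict.Icc_extend'
  have he : ∀ y ∈ Icc α β, IccExtend hαβ ((Icc α β).domRestrict h) y = h y := fun y hy => by
    rw [IccExtend_of_mem hαβ _ hy]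
    rfl
  have h1 := (hc.integral_hasStrictDerivAt α x).hasDerivAt.hasDerivWithinAt (s := Icc α β)
  rw [he x hx] at h1
  refine h1.congr (fun y hy => ?_) ?_ <;>
  · refine intervalIntegral.integral_congr fun t ht => (he t ?_).symm
    exact uIcc_subset_Icc (left_mem_Icc.2 hαβ) (by assumption) ht

theorem integral_eq_sub_of_hasDerivWithinAt_Icc {f g : ℝ → ℝ}
    (hf : ∀ x ∈ Icc α β, HasDerivWithinAt f (g x) (Icc α β) x) (hg : ContinuousOn g (Icc α β))
    {x : ℝ} (hx : x ∈ Icc α β) : ∫ t in α..x, g t = f x - f α := by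
  have hsub : Icc α x ⊆ Icc α β := Icc_subset_Icc_right hx.2
  refine intervalIntegral.integral_eq_sub_of_hasDerivAt_of_le hx.1
    (fun y hy => ((hf y (hsub hy)).continuousWithinAt.mono hsub))
    (fun y hy => (hf y (hsub (Ioo_subset_Icc_self hy))).hasDerivAt
      (Icc_mem_nhds hy.1 (hy.2.trans_le hx.2))) ?_
  refine (hg.mono ?_).intervalIntegrable
  rw [uIcc_of_le hx.1]
  exact hsub

/-- Integration by parts against a function whose derivative `h` is continuous. -/
theorem integral_mul_dfn (hαβ : α ≤ β) {f h : ℝ → ℝ}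
    (hf : ∀ x ∈ Icc α β, HasDerivWithinAt f (h x) (Icc α β) x) (hh : ContinuousOn h (Icc α β))
    (v : H10 α β) :
    ∫ x in Ioo α β, f x * dfn v x = f β * rep v β - ∫ x in Ioo α β, h x * rep v x := by
  have hα := left_mem_Icc.2 hαβ
  have hβ := right_mem_Icc.2 hαβ
  have hu : uIcc α β = Icc α β := uIcc_of_le hαβ
  have hv := intervalIntegrable_dfn v hα hβ
  have hhi : IntervalIntegrable h volume α β := by
    refine ContinuousOn.intervalIntegrable ?_
    rwa [hu]
  have hfc : ContinuousOn f (uIcc α β) := by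
    rw [hu]
    exact fun x hx => (hf x hx).continuousWithinAt
  have hvc : ContinuousOn (rep v) (uIcc α β) := by
    rw [hu]
    exact rep_continuousOn v
  have h1 := integral_primitive_mul_add hhi hv
  -- The primitive of `h` is f - f α; the constant f α contributes the same multiple of `rep v β` to
  -- both sides and cancels.
  have h2 : ∫ x in α..β, (h x * (∫ t in α..x, dfn v t) + (∫ t in α..x, h t) * dfn v x)
      = ∫ x in α..β, (h x * rep v x + (f x * dfn v x - f α * dfn v x)) := by
    refine intervalIntegral.integral_congr fun x hx => ?_
    rw [hu] at hx
    rw [integral_eq_sub_of_hasDerivWithinAt_Icc hf hh hx, rep]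
    ring
  rw [h2, integral_eq_sub_of_hasDerivWithinAt_Icc hf hh hβ, intervalIntegral.integral_add
    (hhi.mul_continuousOn hvc) ((hv.continuousOn_mul hfc).sub (hv.const_mul _)),
    intervalIntegral.integral_sub (hv.continuousOn_mul hfc) (hv.const_mul _),
    intervalIntegral.integral_const_mul] at h1
  rw [setIntegral_Ioo_eq hαβ, setIntegral_Ioo_eq hαβ]
  simp only [rep] at h1 ⊢
  linarith

theorem integral_dfn_mul_rep_add (hαβ : α ≤ β) (u v : H10 α β) :
    ∫ x in Ioo α β, (dfn u x * rep v x + rep u x * dfn v x) = rep u β * rep v β := by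
  rw [setIntegral_Ioo_eq hαβ]
  exact integral_primitive_mul_add (intervalIntegrable_dfn u (left_mem_Icc.2 hαβ)
    (right_mem_Icc.2 hαβ)) (intervalIntegrable_dfn v (left_mem_Icc.2 hαβ) (right_mem_Icc.2 hαβ))

theorem massForm_sub_smul {V : ℝ → ℝ} (hV : ContinuousOn V (Icc α β)) (c d lam : ℝ)
    (u v : H10 α β) :
    massForm V c u v - lam * massForm (fun _ => 1) d u v
      = (∫ x in Ioo α β, (V x - lam) * rep u x * rep v x) + (c - lam * d) * rep u β * rep v β := by
  have hu := rep_continuousOn u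
  have hv := rep_continuousOn v
  have hint1 : IntegrableOn (fun x => V x * rep u x * rep v x) (Ioo α β) :=
    integrableOn_Ioo_of_continuousOn ((hV.mul hu).mul hv)
  have hint2 : IntegrableOn (fun x => 1 * rep u x * rep v x) (Ioo α β) :=
    integrableOn_Ioo_of_continuousOn ((continuousOn_const.mul hu).mul hv)
  have h1 : ∫ x in Ioo α β, (V x - lam) * rep u x * rep v x
      = (∫ x in Ioo α β, V x * rep u x * rep v x)
        - lam * ∫ x in Ioo α β, 1 * rep u x * rep v x := by
    rw [← integral_const_mul, ← integral_sub hint1 (hint2.const_mul _)]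
    congr 1
    funext x
    ring
  rw [h1, massForm, massForm]
  ring

/-- A du Bois-Reymond argument: take `f` to be the primitive of (V - lam) u with the value at β that
the natural boundary condition dictates. The weak equation says that u' - f is orthogonal to every
v', and surjectivity of the weak derivative allows v' = u' - f. -/
theorem classical_of_weak (hαβ : α < β) {V : ℝ → ℝ} (hV : ContinuousOn V (Icc α β)) {c d lam : ℝ}
    {u : H10 α β}
    (hu : ∀ v, dirichletForm u v + massForm V c u v = lam * massForm (fun _ => 1) d u v) :
    ∃ f : ℝ → ℝ, (∀ x ∈ Icc α β, HasDerivWithinAt (rep u) (f x) (Icc α β) x) ∧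
      (∀ x ∈ Icc α β, HasDerivWithinAt f ((V x - lam) * rep u x) (Icc α β) x) ∧
      f β = (lam * d - c) * rep u β := by
  have hβ := right_mem_Icc.2 hαβ.le
  set h : ℝ → ℝ := fun x => (V x - lam) * rep u x with hh
  have hhc : ContinuousOn h (Icc α β) := (hV.sub continuousOn_const).mul (rep_continuousOn u)
  set F : ℝ → ℝ := fun x => ∫ t in α..x, h t with hF
  set f : ℝ → ℝ := fun x => F x - F β + (lam * d - c) * rep u β with hf
  have hfd : ∀ x ∈ Icc α β, HasDerivWithinAt f (h x) (Icc α β) x := fun x hx =>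
    ((hasDerivWithinAt_primitive hαβ.le hhc hx).sub_const _).add_const _
  have hfβ : f β = (lam * d - c) * rep u β := by simp [hf]
  have hfc : ContinuousOn f (Icc α β) := fun x hx => (hfd x hx).continuousWithinAt
  have hfL := memLp_two_of_continuousOn hfc
  have horth : ∀ v : H10 α β, ∫ x in Ioo α β, (dfn u x - f x) * dfn v x = 0 := by
    intro v
    have h1 := hu v
    have h2 := massForm_sub_smul hV c d lam u v
    have h3 := integral_mul_dfn hαβ.le hfd hhc v
    rw [hfβ] at h3
    have h4 : ∫ x in Ioo α β, (dfn u x - f x) * dfn v x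
        = dirichletForm u v - ∫ x in Ioo α β, f x * dfn v x := by
      have hint : IntegrableOn (fun x => f x * dfn v x) (Ioo α β) :=
        hfL.integrable_mul (Lp.memLp (weakDeriv α β v))
      rw [dirichletForm, ← integral_sub (integrableOn_dfn_mul_dfn u v) hint]
      congr 1
      funext x
      ring
    rw [h4, h3]
    linarith
  have hae : dfn u =ᵐ[vol α β] f := by
    have hmem : MemLp (fun x => dfn u x - f x) 2 (vol α β) := (Lp.memLp (weakDeriv α β u)).sub hfL
    obtain ⟨v, hv⟩ := exists_dfn_eq hαβ hmem
    have h1 : ∫ x in Ioo α β, (dfn u x - f x) * (dfn u x - f x) = 0 := by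
      rw [← horth v]
      apply integral_congr_ae
      filter_upwards [hv] with x hx
      rw [hx]
    rw [integral_eq_zero_iff_of_nonneg (fun x => mul_self_nonneg _)
      (hmem.integrable_mul hmem)] at h1
    filter_upwards [h1] with x hx
    simpa [sub_eq_zero] using hx
  refine ⟨f, fun x hx => ?_, hfd, hfβ⟩
  refine (hasDerivWithinAt_primitive hαβ.le hfc hx).congr (fun y hy => ?_) ?_ <;>
  exact intervalIntegral_congr_vol hae (left_mem_Icc.2 hαβ.le) (by assumption)

/-- Since R α = 0, the element with weak derivative `f` has representative R on the interval; the
boundary condition is what matches the boundary terms after integration by parts. -/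
theorem weak_of_classical (hαβ : α < β) {V : ℝ → ℝ} (hV : ContinuousOn V (Icc α β)) {c d lam : ℝ}
    {R f : ℝ → ℝ} (hR : ∀ x ∈ Icc α β, HasDerivWithinAt R (f x) (Icc α β) x)
    (hf : ∀ x ∈ Icc α β, HasDerivWithinAt f ((V x - lam) * R x) (Icc α β) x)
    (hα : R α = 0) (hβ : f β = (lam * d - c) * R β) :
    ∃ u : H10 α β, EqOn (rep u) R (Icc α β) ∧
      ∀ v, dirichletForm u v + massForm V c u v = lam * massForm (fun _ => 1) d u v := by
  have hfc : ContinuousOn f (Icc α β) := fun x hx => (hf x hx).continuousWithinAt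
  have hRc : ContinuousOn R (Icc α β) := fun x hx => (hR x hx).continuousWithinAt
  obtain ⟨u, hu⟩ := exists_dfn_eq hαβ (memLp_two_of_continuousOn hfc)
  have hrep : EqOn (rep u) R (Icc α β) := fun x hx => by
    rw [rep, intervalIntegral_congr_vol hu (left_mem_Icc.2 hαβ.le) hx,
      integral_eq_sub_of_hasDerivWithinAt_Icc hR hfc hx, hα, sub_zero]
  refine ⟨u, hrep, fun v => ?_⟩
  have h1 := massForm_sub_smul hV c d lam u v
  have h2 := integral_mul_dfn hαβ.le hf ((hV.sub continuousOn_const).mul hRc) v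
  have h3 : dirichletForm u v = ∫ x in Ioo α β, f x * dfn v x := by
    apply integral_congr_ae
    filter_upwards [hu] with x hx
    rw [hx]
  have h4 : ∫ x in Ioo α β, (V x - lam) * rep u x * rep v x
      = ∫ x in Ioo α β, (V x - lam) * R x * rep v x := by
    refine setIntegral_congr_fun measurableSet_Ioo fun x hx => ?_
    rw [hrep (Ioo_subset_Icc_self hx)]
  rw [h4, hrep (right_mem_Icc.2 hαβ.le)] at h1
  rw [hβ] at h2
  rw [h3, h2]
  linarith

end Forms

/-! ### The truncated Robin Regge-Wheeler problem -/

section Problem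

variable {M k : ℝ}

/-- The coefficient `6 M k² / (ℓ(ℓ+1) - 2)` of the boundary term of the energy. -/
def robinEnergy (M k : ℝ) (ℓ : ℕ) : ℝ := 6 * M * k ^ 2 / (ang ℓ - 2)

/-- The coefficient `12 M / (ℓ(ℓ+1) (ℓ(ℓ+1) - 2))` of the boundary term of the mass. -/
def robinMass (M : ℝ) (ℓ : ℕ) : ℝ := 12 * M / (ang ℓ * (ang ℓ - 2))

theorem robinEnergy_nonneg (hM : 0 < M) {ℓ : ℕ} (hℓ : 2 ≤ ℓ) : 0 ≤ robinEnergy M k ℓ := by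
  have := six_le_ang hℓ
  have h : 0 < ang ℓ - 2 := by linarith
  unfold robinEnergy
  positivity

theorem robinMass_nonneg (hM : 0 < M) {ℓ : ℕ} (hℓ : 2 ≤ ℓ) : 0 ≤ robinMass M ℓ := by
  have := six_le_ang hℓ
  have h : 0 < ang ℓ - 2 := by linarith
  have h' : 0 < ang ℓ := by linarith
  unfold robinMass
  positivity

theorem continuousOn_potential (hM : 0 < M) (hk : 0 < k) (ℓ : ℕ) :
    ContinuousOn (potential M k ℓ) (Icc (rStar3M M k) (Real.pi / 2)) :=
  (contDiffOn_potential hM hk ℓ).continuousOn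

theorem integral_energy_eq (hM : 0 < M) (hk : 0 < k) (ℓ : ℕ) (u v : Space M k) :
    ∫ x in Ioo (rStar3M M k) (Real.pi / 2), (dfn u x * dfn v x + potential M k ℓ x * fn u x * fn v x)
      = dirichletForm u v
        + ∫ x in Ioo (rStar3M M k) (Real.pi / 2), potential M k ℓ x * rep u x * rep v x := by
  have hint : IntegrableOn (fun x => potential M k ℓ x * rep u x * rep v x)
      (Ioo (rStar3M M k) (Real.pi / 2)) := integrableOn_Ioo_of_continuousOn
    (((continuousOn_potential hM hk ℓ).mul (rep_continuousOn u)).mul (rep_continuousOn v))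
  rw [dirichletForm, ← integral_add (integrableOn_dfn_mul_dfn u v) hint]
  apply integral_congr_ae
  filter_upwards [rep_ae u, rep_ae v] with x hu hv
  rw [hu, hv]

theorem formA_eq (hM : 0 < M) (hk : 0 < k) (ℓ : ℕ) (u v : Space M k) :
    formA M k ℓ u v
      = dirichletForm u v + massForm (potential M k ℓ) (robinEnergy M k ℓ) u v := by
  have h : ∫ x in Ioo (rStar3M M k) (Real.pi / 2), (dfn u x * fn v x + fn u x * dfn v x)
      = rep u (Real.pi / 2) * rep v (Real.pi / 2) := by
    rw [← integral_dfn_mul_rep_add (rStar3M_lt hM hk).le u v]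
    apply integral_congr_ae
    filter_upwards [rep_ae u, rep_ae v] with x hu hv
    rw [hu, hv]
  rw [formA, integral_energy_eq hM hk, h, massForm, robinEnergy]
  ring

theorem twistedRayleigh_eq (hM : 0 < M) (hk : 0 < k) (ℓ : ℕ) (u : Space M k) :
    twistedRayleigh M k ℓ u = formA M k ℓ u u / massForm (fun _ => 1) (robinMass M ℓ) u u := by
  have h1 : ∫ x in Ioo (rStar3M M k) (Real.pi / 2), (dfn u x ^ 2 + potential M k ℓ x * fn u x ^ 2)
      = ∫ x in Ioo (rStar3M M k) (Real.pi / 2),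
        (dfn u x * dfn u x + potential M k ℓ x * fn u x * fn u x) := by
    congr 1
    funext x
    ring
  have h2 : ∫ x in Ioo (rStar3M M k) (Real.pi / 2), fn u x ^ 2
      = ∫ x in Ioo (rStar3M M k) (Real.pi / 2), 1 * rep u x * rep u x := by
    apply integral_congr_ae
    filter_upwards [rep_ae u] with x hu
    rw [hu]
    ring
  rw [twistedRayleigh, h1, h2, integral_energy_eq hM hk, formA_eq hM hk, massForm, massForm,
    robinEnergy, robinMass]
  congr 1 <;> ring

theorem robin_iff (hM : 0 < M) {ℓ : ℕ} (hℓ : 2 ≤ ℓ) (lam y y' : ℝ) :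
    -2 * lam * y + ang ℓ * (ang ℓ - 2) / (6 * M) * y' + k ^ 2 * ang ℓ * y = 0 ↔
      y' = (lam * robinMass M ℓ - robinEnergy M k ℓ) * y := by
  have h6 := six_le_ang hℓ
  have h0 : ang ℓ ≠ 0 := by linarith
  have h2 : ang ℓ - 2 ≠ 0 := by linarith
  have hM' := hM.ne'
  have h : -2 * lam * y + ang ℓ * (ang ℓ - 2) / (6 * M) * y' + k ^ 2 * ang ℓ * y
      = ang ℓ * (ang ℓ - 2) / (6 * M) *
        (y' - (lam * robinMass M ℓ - robinEnergy M k ℓ) * y) := by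
    unfold robinMass robinEnergy
    field_simp
    ring
  rw [h, mul_eq_zero, sub_eq_zero, or_iff_right]
  exact div_ne_zero (mul_ne_zero h0 h2) (by positivity)

theorem iteratedDerivWithin_two_eq {s : Set ℝ} (hs : UniqueDiffOn ℝ s) {R f g : ℝ → ℝ}
    (hR : ∀ x ∈ s, HasDerivWithinAt R (f x) s x) (hf : ∀ x ∈ s, HasDerivWithinAt f (g x) s x)
    {x : ℝ} (hx : x ∈ s) : iteratedDerivWithin 2 R s x = g x := by
  rw [iteratedDerivWithin_succ, iteratedDerivWithin_one, ← (hf x hx).derivWithin (hs x hx)]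
  exact derivWithin_congr (fun y hy => (hR y hy).derivWithin (hs y hy))
    ((hR x hx).derivWithin (hs x hx))

/-- As a first-order system the problem requires only differentiability; smoothness up to both ends
then follows from that of the potential. -/
theorem isRobinSolution_iff (hM : 0 < M) (hk : 0 < k) {ℓ : ℕ} (hℓ : 2 ≤ ℓ) {ω : ℝ} {R : ℝ → ℝ} :
    IsRobinSolution M k ℓ ω R ↔ R (rStar3M M k) = 0 ∧ ∃ f : ℝ → ℝ,
      (∀ x ∈ interval M k, HasDerivWithinAt R (f x) (interval M k) x) ∧
      (∀ x ∈ interval M k,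
        HasDerivWithinAt f ((potential M k ℓ x - ω ^ 2) * R x) (interval M k) x) ∧
      f (Real.pi / 2) = (ω ^ 2 * robinMass M ℓ - robinEnergy M k ℓ) * R (Real.pi / 2) := by
  have hs := uniqueDiffOn_interval hM hk
  have hβ : Real.pi / 2 ∈ interval M k := right_mem_Icc.2 (rStar3M_lt hM hk).le
  constructor
  · intro h
    have h1 : ContDiffOn ℝ (⊤ : ℕ∞) (derivWithin R (interval M k)) (interval M k) :=
      ((contDiffOn_infty_iff_derivWithin hs).1 h.smooth).2
    have hR : ∀ x ∈ interval M k,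
        HasDerivWithinAt R (derivWithin R (interval M k) x) (interval M k) x := fun x hx =>
      (h.smooth.differentiableOn (by simp) x hx).hasDerivWithinAt
    have hR' : ∀ x ∈ interval M k, HasDerivWithinAt (derivWithin R (interval M k))
        (derivWithin (derivWithin R (interval M k)) (interval M k) x) (interval M k) x :=
      fun x hx => (h1.differentiableOn (by simp) x hx).hasDerivWithinAt
    refine ⟨h.dirichlet, derivWithin R (interval M k), hR, fun x hx => ?_, ?_⟩
    · refine (hR' x hx).congr_deriv ?_
      have h2 := h.equation x hx
      rw [iteratedDerivWithin_two_eq hs hR hR' hx] at h2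
      linarith
    · exact (robin_iff hM hℓ _ _ _).1 h.robin
  · rintro ⟨h0, f, hR, hf, hfβ⟩
    refine ⟨?_, fun x hx => ?_, h0, ?_⟩
    · exact contDiffOn_of_linear_second_order hs
        ((contDiffOn_potential hM hk ℓ).sub contDiffOn_const) hR hf
    · rw [iteratedDerivWithin_two_eq hs hR hf hx]
      ring
    · rw [(hR _ hβ).derivWithin (hs _ hβ)]
      exact (robin_iff hM hℓ _ _ _).2 hfβ

theorem isRobinSolution_rep (hM : 0 < M) (hk : 0 < k) {ℓ : ℕ} (hℓ : 2 ≤ ℓ) {ω : ℝ} {u : Space M k}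
    (hu : ∀ v, formA M k ℓ u v = ω ^ 2 * massForm (fun _ => 1) (robinMass M ℓ) u v) :
    IsRobinSolution M k ℓ ω (rep u) := by
  rw [isRobinSolution_iff hM hk hℓ]
  refine ⟨rep_left u, classical_of_weak (rStar3M_lt hM hk) (continuousOn_potential hM hk ℓ) ?_⟩
  intro v
  rw [← formA_eq hM hk, hu]

theorem IsRobinSolution.exists_rep_eq (hM : 0 < M) (hk : 0 < k) {ℓ : ℕ} (hℓ : 2 ≤ ℓ) {ω : ℝ}
    {R : ℝ → ℝ} (hR : IsRobinSolution M k ℓ ω R) :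
    ∃ u : Space M k, EqOn (rep u) R (interval M k) ∧
      ∀ v, formA M k ℓ u v = ω ^ 2 * massForm (fun _ => 1) (robinMass M ℓ) u v := by
  obtain ⟨h0, f, hR1, hR2, hR3⟩ := (isRobinSolution_iff hM hk hℓ).1 hR
  obtain ⟨u, hu1, hu2⟩ := weak_of_classical (rStar3M_lt hM hk) (continuousOn_potential hM hk ℓ)
    hR1 hR2 h0 hR3
  exact ⟨u, hu1, fun v => by rw [formA_eq hM hk, hu2]⟩

end Problem

end ReggeWheeler

end

/-! ### Spectral theory of the energy form relative to the mass form -/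

theorem proposition4p4 (M k : ℝ) (hM : 0 < M) (hk : 0 < k) (ℓ : ℕ) (hℓ : 2 ≤ ℓ) :
    ReggeWheeler.IsHilbertScalarProduct (ReggeWheeler.formA M k ℓ) ∧
    ∃ (ω : ℕ → ℝ) (e : ℕ → ReggeWheeler.Space M k),
      ReggeWheeler.IsHilbertBasisFor (ReggeWheeler.formA M k ℓ) e ∧
      (∀ n, ReggeWheeler.IsRobinSolution M k ℓ (ω n) (ReggeWheeler.rep (e n))) ∧
      ReggeWheeler.eigenvalues M k ℓ = Set.range (fun n => ω n ^ 2) ∧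
      IsLeast (ReggeWheeler.eigenvalues M k ℓ) (ω 0 ^ 2) ∧
      IsGLB (ReggeWheeler.twistedRayleigh M k ℓ '' {R | R ≠ 0}) (ω 0 ^ 2) ∧
      ReggeWheeler.twistedRayleigh M k ℓ (e 0) = ω 0 ^ 2 := by
  open ReggeWheeler in
  have hαβ := rStar3M_lt hM hk
  obtain ⟨B, hB, hBc⟩ := exists_energyForm hαβ.le (continuousOn_potential hM hk ℓ)
    (fun x hx => potential_nonneg hM hk hℓ hx) (robinEnergy_nonneg (k := k) hM hℓ)
  obtain ⟨b, hb, hbc⟩ := exists_massForm hαβ.le (ρ := fun _ => 1) continuousOn_const (robinMass M ℓ)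
  have hBA : ∀ u v, B u v = formA M k ℓ u v := fun u v => by rw [hB, formA_eq hM hk]
  have hAs : ∀ u v, formA M k ℓ u v = formA M k ℓ v u := fun u v => by
    rw [formA_eq hM hk, formA_eq hM hk, dirichletForm_comm, massForm_comm]
  obtain ⟨lam, e, hpos, hmin, hon, hdense, heig, hray⟩ := exists_eigenbasis_of_isCoercive B b
    (fun u v => by rw [hBA, hBA, hAs]) hBc (fun u v => by rw [hb, hb, massForm_comm])
    (fun u hu => by
      rw [hb]
      exact massForm_one_pos hαβ.le (robinMass_nonneg hM hℓ) hu) hbc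
    (not_finiteDimensional_H10 hαβ)
  simp only [hBA, hb] at hon heig hray
  have hsq : ∀ n, √(lam n) ^ 2 = lam n := fun n => Real.sq_sqrt (hpos n).le
  have hne : ∀ n, e n ≠ 0 := fun n h => by
    have h1 := hon n n
    rw [h, ← hBA, map_zero] at h1
    simp at h1
  have hrayl : ∀ n, twistedRayleigh M k ℓ (e n) = lam n := fun n => by
    have h1 := heig n (e n)
    have h2 := massForm_one_pos hαβ.le (robinMass_nonneg hM hℓ) (hne n)
    rw [twistedRayleigh_eq hM hk, h1, mul_div_assoc, div_self h2.ne', mul_one]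
  have hsol : ∀ n, IsRobinSolution M k ℓ √(lam n) (rep (e n)) := fun n =>
    isRobinSolution_rep hM hk hℓ fun v => by rw [hsq, heig]
  have hspec : eigenvalues M k ℓ = range lam := by
    ext μ
    constructor
    · rintro ⟨ω, R, rfl, hR, x, hx, hRx⟩
      obtain ⟨u, hu1, hu2⟩ := hR.exists_rep_eq hM hk hℓ
      by_contra hμ
      -- Comparing the weak equations of `u` and `e n` gives (lam n - ω²) b(u, e n) = 0; as ω² is no
      -- `lam n`, b(u, e n) and then a(u, e n) vanish. Density and coercivity will force u = 0.
      have horth : ∀ n, B u (e n) = 0 := fun n => by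
        have h1 := hu2 (e n)
        have h2 := heig n u
        rw [hAs, massForm_comm] at h2
        have h3 : lam n - ω ^ 2 ≠ 0 := fun h => hμ ⟨n, sub_eq_zero.1 h⟩
        have h4 : (lam n - ω ^ 2) * massForm (fun _ => 1) (robinMass M ℓ) u (e n) = 0 := by
          linarith
        rw [hBA, h1, (mul_eq_zero.1 h4).resolve_left h3, mul_zero]
      have hBu : B u = 0 := by
        have h1 : Submodule.span ℝ (range e) ≤ (B u).ker := by
          rw [Submodule.span_le]
          rintro _ ⟨n, rfl⟩
          exact horth n
        have h2 := Continuous.ext_on hdense (B u).continuous continuous_const (g := fun _ => 0)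
          fun v hv => h1 hv
        ext v
        exact congrFun h2 v
      have hu0 : u = 0 := by
        obtain ⟨C, hC, h⟩ := hBc
        by_contra hne
        have h1 := h u
        rw [hBu] at h1
        have h2 : 0 < ‖u‖ := norm_pos_iff.2 hne
        have h3 : 0 < C * ‖u‖ * ‖u‖ := by positivity
        exact absurd h1 (not_le.2 h3)
      rw [← hu1 hx, hu0] at hRx
      have h5 := rep_smul 0 (0 : Space M k) hx
      rw [smul_zero, zero_mul] at h5
      exact hRx h5
    · rintro ⟨n, rfl⟩
      refine ⟨√(lam n), rep (e n), (hsq n).symm, hsol n, ?_⟩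
      by_contra! h
      exact hne n (eq_zero_of_rep_eq_zero hαβ.le fun x hx => h x (Ioo_subset_Icc_self hx))
  refine ⟨⟨B, hBA, hAs, hBc⟩, fun n => √(lam n), e, ⟨hon, hdense⟩, hsol, ?_, ?_, ⟨?_, ?_⟩, ?_⟩
  · simp only [hsq]
    exact hspec
  · rw [hspec, hsq]
    refine ⟨⟨0, rfl⟩, ?_⟩
    rintro _ ⟨n, rfl⟩
    exact hmin n
  · rintro _ ⟨u, hu, rfl⟩
    rw [hsq, twistedRayleigh_eq hM hk,
      le_div_iff₀ (massForm_one_pos hαβ.le (robinMass_nonneg hM hℓ) hu)]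
    exact hray u
  · intro y hy
    rw [hsq, ← hrayl 0]
    exact hy ⟨e 0, hne 0, rfl⟩
  · rw [hsq, hrayl]
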